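/- **Setting.** Let $Z\in\mathbb R^K$, $E\in\mathbb R^p$, $\varepsilon\in\mathbb R$ be mutually independent, mean-zero, square-integrable random variables with $K\ge 1$, and put $\Sigma_Z=\mathrm{Cov}(Z)$, $\Sigma_E=\mathrm{Cov}(E)$, $\sigma_\varepsilon^2=\mathrm{Var}(\varepsilon)$. For $A\in\mathbb R^{p\times K}$ and $\beta\in\mathbb R^K$ let $X_i=AZ_i+E_i$, $y_i=Z_i^\top\beta+\varepsilon_i$ $(1\le i\le n)$, where $(Z_i,E_i,\varepsilon_i)$ are i.i.d. copies of $(Z,E,\varepsilon)$. Let $\mathbf X\in\mathbb R^{n\times p}$ have rows $X_i$, let $\mathbf y=(y_1,\dots,y_n)^\top$, and let $$\widehat\alpha=\arg\min\{\|\alpha\| : \|\mathbf X\alpha-\mathbf y\|=\min_u\|\mathbf Xu-\mathbf y\|\}$$ be the minimum-norm estimator. Write $\|\beta\|_{\Sigma_Z}^2=\beta^\top\Sigma_Z\beta$, let $\lambda_K(Q)$ be the $K$-th largest eigenvalue of a symmetric matrix $Q$, and let $\mathrm r_e(\Sigma_E)=\mathrm{tr}(\Sigma_E)/\|\Sigma_E\|$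 be the effective rank, with operator norm $\|\Sigma_E\|$ (and $\mathrm r_e(0)=1$). Let $M\ge 0$, and for a real random variable $U$ let $\|U\|_{\psi_2}=\inf\{t>0:\mathbb E\exp(U^2/t^2)\le 2\}$. For a constant $C>0$, consider the conditions: * $A$ and $\Sigma_Z$ have rank $K$; * $E=\Sigma_E^{1/2}\tilde E$, where $\tilde E$ has independent entries with mean zero, unit variance and $\psi_2$-norm at most $M$; $Z=\Sigma_Z^{1/2}\tilde Z$ and $\varepsilon=\sigma_\varepsilon\tilde\varepsilon$, where $\tilde Z$ and $\tilde\varepsilon$ have mean zero, and the entries of $\tilde Z$, and $\tilde\varepsilon$, have $\psi_2$-norm at most $M$; * $n>C\,K$ and $\mathrm r_e(\Sigma_E)>C\,n$. **Statement.** There are constants $C,c>0$ depending only on $M$ such that the following hold. 1. There is a constant $C'>0$ depending only on $M$ such that, whenever the conditions hold, with probability exceeding $1-c/n$, $$\|\widehat\alpha\|^2\le C'\left(\frac{\|\beta\|^2_{\Sigma_Z}}{\lambda_K(A\Sigma_ZA^\top)}+\sigma_\varepsilon^2\,\frac{n\log n}{\mathrm{tr}(\Sigma_E)}\right),\qquad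 \mathrm{tr}(\Sigma_E)=\|\Sigma_E\|\,\mathrm r_e(\Sigma_E).$$ 2. For every $\kappa>0$ there is a constant $C'>0$ depending only on $M$ and $\kappa$ such that, whenever the conditions hold and $\|\Sigma_E\|\ge\kappa$, with probability exceeding $1-c/n$, $$\|\widehat\alpha\|^2\le C'\left(\frac{\|\beta\|^2_{\Sigma_Z}}{\lambda_K(A\Sigma_ZA^\top)}+\sigma_\varepsilon^2\,\frac{n\log n}{\mathrm r_e(\Sigma_E)}\right).$$ 3. Consequently, along any sequence of such models, with varying $n,p,K$ and all satisfying the conditions with these $M$ and $C$, for which $n\to\infty$, $\|\beta\|^2_{\Sigma_Z}/\lambda_K(A\Sigma_ZA^\top)\to0$ and $\sigma_\varepsilon^2\,n\log n/\mathrm{tr}(\Sigma_E)\to0$, one has $\|\widehat\alpha\|\to0$ in probability. -/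

import Mathlib

open MeasureTheory ProbabilityTheory Filter Topology
open scoped NNReal ENNReal MatrixOrder

universe u v

noncomputable section

/-! ### Minimum-norm least squares -/

/-- `a` minimises `u ↦ ‖X u - y‖` (Euclidean norm). -/
def IsLeastSquares {n p : ℕ} (X : Matrix (Fin n) (Fin p) ℝ) (y : EuclideanSpace ℝ (Fin n))
    (a : EuclideanSpace ℝ (Fin p)) : Prop :=
  ∀ u : EuclideanSpace ℝ (Fin p),
    ‖Matrix.toEuclideanLin X a - y‖ ≤ ‖Matrix.toEuclideanLin X u - y‖

/-- `a` has the smallest Euclidean norm among the minimisers of `u ↦ ‖X u - y‖`. -/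
def IsMinNormLeastSquares {n p : ℕ} (X : Matrix (Fin n) (Fin p) ℝ)
    (y : EuclideanSpace ℝ (Fin n)) (a : EuclideanSpace ℝ (Fin p)) : Prop :=
  IsLeastSquares X y a ∧ ∀ b, IsLeastSquares X y b → ‖a‖ ≤ ‖b‖

/-- The minimum-norm least-squares solution exists and is unique. -/
theorem existsUnique_isMinNormLeastSquares {n p : ℕ} (X : Matrix (Fin n) (Fin p) ℝ)
    (y : EuclideanSpace ℝ (Fin n)) : ∃! a, IsMinNormLeastSquares X y a := by
  set T := Matrix.toEuclideanLin X with hT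
  set R := LinearMap.range T with hR
  set N := LinearMap.ker T with hN
  have hpy : ∀ w : EuclideanSpace ℝ (Fin p),
      ‖T w - y‖ ^ 2 = ‖T w - R.starProjection y‖ ^ 2 + ‖R.starProjection y - y‖ ^ 2 := by
    intro w
    have h1 : T w - y = (T w - R.starProjection y) + (R.starProjection y - y) := by abel
    have h2 : inner ℝ (T w - R.starProjection y) (R.starProjection y - y) = (0 : ℝ) := by
      have h3 : T w - R.starProjection y ∈ R :=
        R.sub_mem (LinearMap.mem_range_self T w) (R.starProjection_apply_mem y)
      have h4 := R.sub_starProjection_mem_orthogonal y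
      have h5 := (Submodule.mem_orthogonal R _).1 h4 _ h3
      rw [← neg_sub y, inner_neg_right, h5, neg_zero]
    rw [h1, norm_add_sq_real, h2]
    ring
  obtain ⟨a0, ha0⟩ : ∃ a0, T a0 = R.starProjection y := R.starProjection_apply_mem y
  have hls : ∀ w, IsLeastSquares X y w ↔ T w = R.starProjection y := by
    intro w
    constructor
    · intro h
      have h1 := h a0
      rw [← hT] at h1
      have h2 := pow_le_pow_left₀ (norm_nonneg _) h1 2
      rw [hpy, hpy, ha0, sub_self, norm_zero] at h2
      have h3 : ‖T w - R.starProjection y‖ ^ 2 = 0 :=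
        le_antisymm (by linarith) (sq_nonneg _)
      exact sub_eq_zero.1 (norm_eq_zero.1 (pow_eq_zero_iff two_ne_zero |>.1 h3))
    · intro h u
      rw [← hT]
      refine (sq_le_sq₀ (norm_nonneg _) (norm_nonneg _)).1 ?_
      rw [hpy, hpy u, h, sub_self, norm_zero]
      have := sq_nonneg ‖T u - R.starProjection y‖
      linarith
  set a := a0 - N.starProjection a0 with ha
  have haN : a ∈ Nᗮ := N.sub_starProjection_mem_orthogonal a0
  have hTa : T a = R.starProjection y := by
    have : T (N.starProjection a0) = 0 := N.starProjection_apply_mem a0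
    rw [ha, map_sub, this, sub_zero, ha0]
  have hnorm : ∀ b, IsLeastSquares X y b → ‖b‖ ^ 2 = ‖a‖ ^ 2 + ‖b - a‖ ^ 2 := by
    intro b hb
    have h1 : b - a ∈ N := by
      rw [hN, LinearMap.mem_ker, map_sub, (hls b).1 hb, hTa, sub_self]
    have h2 := (Submodule.mem_orthogonal' N _).1 haN _ h1
    have h3 : b = a + (b - a) := by abel
    conv_lhs => rw [h3]
    rw [norm_add_sq_real, h2]
    ring
  refine ⟨a, ⟨(hls a).2 hTa, fun b hb => ?_⟩, fun b hb => ?_⟩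
  · refine (sq_le_sq₀ (norm_nonneg _) (norm_nonneg _)).1 ?_
    have := hnorm b hb
    have := sq_nonneg ‖b - a‖
    linarith
  · have h1 := hb.2 a ((hls a).2 hTa)
    have h2 := pow_le_pow_left₀ (norm_nonneg _) h1 2
    have h3 := hnorm b hb.1
    have h4 : ‖b - a‖ ^ 2 = 0 := le_antisymm (by linarith) (sq_nonneg _)
    exact sub_eq_zero.1 (norm_eq_zero.1 (pow_eq_zero_iff two_ne_zero |>.1 h4))

/-- `argmin {‖α‖ : ‖X α - y‖ = min_u ‖X u - y‖}`. -/
def minNormLeastSquares {n p : ℕ} (X : Matrix (Fin n) (Fin p) ℝ)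
    (y : EuclideanSpace ℝ (Fin n)) : EuclideanSpace ℝ (Fin p) :=
  Classical.choose (existsUnique_isMinNormLeastSquares X y).exists

theorem isMinNormLeastSquares_minNormLeastSquares {n p : ℕ} (X : Matrix (Fin n) (Fin p) ℝ)
    (y : EuclideanSpace ℝ (Fin n)) : IsMinNormLeastSquares X y (minNormLeastSquares X y) :=
  Classical.choose_spec (existsUnique_isMinNormLeastSquares X y).exists

/-! ### Matrix quantities -/

/-- Euclidean operator norm of a square real matrix. -/
def matrixOpNorm {d : ℕ} (Q : Matrix (Fin d) (Fin d) ℝ) : ℝ :=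
  ‖Matrix.toEuclideanCLM (𝕜 := ℝ) Q‖

open Classical in
/-- Effective rank `tr Q / ‖Q‖`, with the convention that it is `1` for `Q = 0`. -/
def effectiveRank {d : ℕ} (Q : Matrix (Fin d) (Fin d) ℝ) : ℝ :=
  if Q = 0 then 1 else Q.trace / matrixOpNorm Q

open Classical in
/-- The `k`-th largest eigenvalue `λ_k(Q)` (`1 ≤ k ≤ d`, counted with multiplicity) of a real
symmetric `d × d` matrix; the value `0` is used for all other arguments. -/
def orderedEigenvalue {d : ℕ} (Q : Matrix (Fin d) (Fin d) ℝ) (k : ℕ) : ℝ :=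
  if h : Q.IsHermitian ∧ 1 ≤ k ∧ k ≤ d then
    h.1.eigenvalues₀ ⟨k - 1, by rw [Fintype.card_fin]; omega⟩
  else 0

/-! ### Probabilistic quantities -/

/-- Covariance matrix of a random vector. -/
def covarianceMatrix {Ω : Type*} [MeasurableSpace Ω] (P : Measure Ω) {d : ℕ}
    (V : Ω → Fin d → ℝ) : Matrix (Fin d) (Fin d) ℝ :=
  Matrix.of fun j k => cov[fun ω => V ω j, fun ω => V ω k; P]

/-- Sub-Gaussian norm `inf {t > 0 : E exp (U² / t²) ≤ 2}`, equal to `∞` if there is no such `t`. -/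
def psiTwoNorm {Ω : Type*} [MeasurableSpace Ω] (P : Measure Ω) (U : Ω → ℝ) : ℝ≥0∞ :=
  ⨅ (t : ℝ≥0) (_ : 0 < t)
    (_ : ∫⁻ ω, ENNReal.ofReal (Real.exp (U ω ^ 2 / (t : ℝ) ^ 2)) ∂P ≤ 2), (t : ℝ≥0∞)

/-! ### Factor regression -/

/-- The factor regression model `X = A Z + E`, `y = Zᵀ β + ε`, together with a sample of size `n`.
The population variables `(Z, E, ε)` live on `(Ω₀, P₀)`; the triples `(Zs i, Es i, εs i)`,
living on `(Ω, P)`, are i.i.d. copies of `(Z, E, ε)`. -/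
structure FactorRegression (n p K : ℕ) where
  Ω₀ : Type u
  [measurableSpace₀ : MeasurableSpace Ω₀]
  P₀ : Measure Ω₀
  [isProbabilityMeasure₀ : IsProbabilityMeasure P₀]
  A : Matrix (Fin p) (Fin K) ℝ
  β : Fin K → ℝ
  Z : Ω₀ → Fin K → ℝ
  E : Ω₀ → Fin p → ℝ
  ε : Ω₀ → ℝ
  measurable_Z : Measurable Z
  measurable_E : Measurable E
  measurable_ε : Measurable ε
  memLp_Z : ∀ k, MemLp (fun ω => Z ω k) 2 P₀
  memLp_E : ∀ j, MemLp (fun ω => E ω j) 2 P₀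
  memLp_ε : MemLp ε 2 P₀
  mean_Z : ∀ k, ∫ ω, Z ω k ∂P₀ = 0
  mean_E : ∀ j, ∫ ω, E ω j ∂P₀ = 0
  mean_ε : ∫ ω, ε ω ∂P₀ = 0
  /- The next two fields say that `Z`, `E`, `ε` are mutually independent. -/
  indep_Z : IndepFun Z (fun ω => (E ω, ε ω)) P₀
  indep_E : IndepFun E ε P₀
  Ω : Type v
  [measurableSpace : MeasurableSpace Ω]
  P : Measure Ω
  [isProbabilityMeasure : IsProbabilityMeasure P]
  Zs : Fin n → Ω → Fin K → ℝ
  Es : Fin n → Ω → Fin p → ℝ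
  εs : Fin n → Ω → ℝ
  iIndep_sample : iIndepFun (fun i ω => (Zs i ω, Es i ω, εs i ω)) P
  identDistrib_sample : ∀ i,
    IdentDistrib (fun ω => (Zs i ω, Es i ω, εs i ω)) (fun ω => (Z ω, E ω, ε ω)) P P₀

namespace FactorRegression

attribute [instance] measurableSpace₀ isProbabilityMeasure₀ measurableSpace isProbabilityMeasure

variable {n p K : ℕ} (F : FactorRegression.{u, v} n p K)

/-- `Σ_Z = Cov(Z)`. -/
def covZ : Matrix (Fin K) (Fin K) ℝ := covarianceMatrix F.P₀ F.Z

/-- `Σ_E = Cov(E)`. -/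
def covE : Matrix (Fin p) (Fin p) ℝ := covarianceMatrix F.P₀ F.E

/-- `σ_ε² = Var(ε)`. -/
def varε : ℝ := Var[F.ε; F.P₀]

/-- The data matrix, whose `i`-th row is `X_i = A Z_i + E_i`. -/
def X (ω : F.Ω) : Matrix (Fin n) (Fin p) ℝ :=
  Matrix.of fun i => F.A.mulVec (F.Zs i ω) + F.Es i ω

/-- The response vector, with entries `y_i = Z_iᵀ β + ε_i`. -/
def y (ω : F.Ω) : EuclideanSpace ℝ (Fin n) :=
  WithLp.toLp 2 fun i => F.Zs i ω ⬝ᵥ F.β + F.εs i ω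

/-- The minimum-norm estimator `α̂`. -/
def αHat (ω : F.Ω) : EuclideanSpace ℝ (Fin p) := minNormLeastSquares (F.X ω) (F.y ω)

/-- `‖β‖²_{Σ_Z} = βᵀ Σ_Z β`. -/
def signal : ℝ := F.β ⬝ᵥ F.covZ.mulVec F.β

/-- `λ_K(A Σ_Z Aᵀ)`. -/
def signalEigenvalue : ℝ := orderedEigenvalue (F.A * F.covZ * F.A.transpose) K

/-- `A` and `Σ_Z` have full rank `K`. -/
def FullRank : Prop := F.A.rank = K ∧ F.covZ.rank = K

/-- `E = Σ_E^{1/2} Ẽ`, where `Ẽ` has independent, centred entries with unit variance;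
`Z = Σ_Z^{1/2} Z̃` and `ε = σ_ε ε̃` with `Z̃`, `ε̃` centred; the entries of `Ẽ`, those of `Z̃`, and
`ε̃` have sub-Gaussian norm at most `M`. -/
def SubGaussian (M : ℝ≥0) : Prop :=
  (∃ Et : F.Ω₀ → Fin p → ℝ, Measurable Et ∧
    (∀ᵐ ω ∂F.P₀, F.E ω = (CFC.sqrt F.covE).mulVec (Et ω)) ∧
    iIndepFun (fun j ω => Et ω j) F.P₀ ∧
    ∀ j, ∫ ω, Et ω j ∂F.P₀ = 0 ∧ Var[fun ω => Et ω j; F.P₀] = 1 ∧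
      psiTwoNorm F.P₀ (fun ω => Et ω j) ≤ M) ∧
  (∃ Zt : F.Ω₀ → Fin K → ℝ, Measurable Zt ∧
    (∀ᵐ ω ∂F.P₀, F.Z ω = (CFC.sqrt F.covZ).mulVec (Zt ω)) ∧
    ∀ k, ∫ ω, Zt ω k ∂F.P₀ = 0 ∧ psiTwoNorm F.P₀ (fun ω => Zt ω k) ≤ M) ∧
  (∃ εt : F.Ω₀ → ℝ, Measurable εt ∧
    (∀ᵐ ω ∂F.P₀, F.ε ω = Real.sqrt F.varε * εt ω) ∧
    ∫ ω, εt ω ∂F.P₀ = 0 ∧ psiTwoNorm F.P₀ εt ≤ M)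

/-- All conditions on the model, for a sub-Gaussian bound `M` and a constant `C`. -/
structure Conditions (M : ℝ≥0) (C : ℝ) : Prop where
  one_le_K : 1 ≤ K
  fullRank : F.FullRank
  subGaussian : F.SubGaussian M
  n_large : C * K < n
  effectiveRank_large : C * n < effectiveRank F.covE

end FactorRegression

end

/-!
Write `𝐄` for the matrix of the noise vectors, `τ = tr Σ_E`, and let `W` be the range of `A`, of
dimension at most `K`. For a fixed unit vector `u`, the squared norm of `𝐄ᵀ u` concentrates around
`τ`: its exponential moments are estimated by integrating out one coordinate of `Ẽ` at a time, so
that no decoupling is needed. Projecting `𝐄ᵀ u` away from `W` costs at most `K ‖Σ_E‖` of the trace,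
which is a small part of `τ` as the effective rank dominates `K`. A net of the unit sphere of `ℝⁿ`
makes this uniform in `u` outside an event of probability `2 exp (-n)`, because the effective rank
dominates `n`. There `𝐗ᵀ`, which agrees with `𝐄ᵀ` modulo `W`, is bounded below by a multiple of
`√τ`, so `𝐗` is onto and the least-squares solutions are the interpolating ones.

If `Aᵀ a = β`, the residual of `a` contains only noise: `𝐲 - 𝐗 a = ε - 𝐄 a`. Interpolating it costs
at most `‖ε - 𝐄 a‖ / √τ` up to a constant, so `‖α̂‖` is at most of the order of `‖a‖ + ‖ε‖ / √τ`.
Finally, `a` can be chosen with `λ_K(A Σ_Z Aᵀ) ‖a‖² ≤ ‖β‖²_{Σ_Z}`, and a union bound gives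
`ε_i² ≲ σ_ε² log n` for all `i`.
-/

/-! ### Sub-Gaussian laws on the line -/

section ExponentialMoments

theorem exp_le_add_exp_sq (x : ℝ) : Real.exp x ≤ x + Real.exp (x ^ 2) := by
  have hsq := Real.add_one_le_exp (x ^ 2)
  rcases le_total |x| 1 with hx | hx
  · have := (abs_le.1 (Real.abs_exp_sub_one_sub_id_le hx)).2
    linarith
  · rcases le_abs'.1 hx with hx | hx
    · have : Real.exp x ≤ 1 := Real.exp_le_one_iff.2 (by linarith)
      nlinarith
    · have : Real.exp x ≤ Real.exp (x ^ 2) := Real.exp_le_exp.2 (by nlinarith)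
      linarith

theorem exp_mul_le_one_add_mul {s : ℝ} (hs : 0 ≤ s) (hs' : s ≤ 1) (y : ℝ) :
    Real.exp (s * y) ≤ 1 + s * (Real.exp y - 1) := by
  have h := convexOn_exp.2 (Set.mem_univ (0 : ℝ)) (Set.mem_univ y) (sub_nonneg.2 hs') hs (by ring)
  simp only [smul_eq_mul, mul_zero, zero_add, Real.exp_zero] at h
  linarith

theorem exp_neg_le_one_sub_add_sq {y : ℝ} (hy : 0 ≤ y) :
    Real.exp (-y) ≤ 1 - y + y ^ 2 / 2 := by
  have hexp := Real.quadratic_le_exp_of_nonneg hy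
  have hpos : 0 < 1 - y + y ^ 2 / 2 := by nlinarith [sq_nonneg (y - 1)]
  rw [Real.exp_neg, inv_le_iff_one_le_mul₀ (Real.exp_pos y)]
  calc (1 : ℝ) ≤ (1 - y + y ^ 2 / 2) * (1 + y + y ^ 2 / 2) := by nlinarith [pow_nonneg hy 4]
    _ ≤ (1 - y + y ^ 2 / 2) * Real.exp y := by gcongr

theorem pow_four_le_exp_sq {m : ℝ} (hm : m ≠ 0) (x : ℝ) :
    x ^ 4 ≤ 2 * m ^ 4 * Real.exp (x ^ 2 / m ^ 2) := by
  have hexp := Real.quadratic_le_exp_of_nonneg (x := x ^ 2 / m ^ 2) (by positivity)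
  calc x ^ 4 = 2 * m ^ 4 * ((x ^ 2 / m ^ 2) ^ 2 / 2) := by field_simp
    _ ≤ 2 * m ^ 4 * Real.exp (x ^ 2 / m ^ 2) := by
      gcongr
      linarith [show 0 ≤ x ^ 2 / m ^ 2 by positivity]

theorem lintegral_exp_add_le {α : Type*} [MeasurableSpace α] {μ : Measure α} {f g : α → ℝ}
    {s t : ℝ} (hf : AEMeasurable f μ) (hg : AEMeasurable g μ)
    (hf' : ∫⁻ x, ENNReal.ofReal (Real.exp (2 * f x)) ∂μ ≤ ENNReal.ofReal (Real.exp (2 * s)))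
    (hg' : ∫⁻ x, ENNReal.ofReal (Real.exp (2 * g x)) ∂μ ≤ ENNReal.ofReal (Real.exp (2 * t))) :
    ∫⁻ x, ENNReal.ofReal (Real.exp (f x + g x)) ∂μ ≤ ENNReal.ofReal (Real.exp (s + t)) := by
  have hsq (r : ℝ) : ENNReal.ofReal (Real.exp r) ^ (2 : ℝ) = ENNReal.ofReal (Real.exp (2 * r)) := by
    rw [ENNReal.ofReal_rpow_of_pos (Real.exp_pos r), ← Real.exp_mul, mul_comm]
  have hsqrt (r : ℝ) :
      ENNReal.ofReal (Real.exp (2 * r)) ^ (1 / 2 : ℝ) = ENNReal.ofReal (Real.exp r) := by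
    rw [ENNReal.ofReal_rpow_of_pos (Real.exp_pos _), ← Real.exp_mul]
    congr 2
    ring
  calc ∫⁻ x, ENNReal.ofReal (Real.exp (f x + g x)) ∂μ
      = ∫⁻ x, ENNReal.ofReal (Real.exp (f x)) * ENNReal.ofReal (Real.exp (g x)) ∂μ := by
        simp only [Real.exp_add, ENNReal.ofReal_mul (Real.exp_pos _).le]
    _ ≤ (∫⁻ x, ENNReal.ofReal (Real.exp (f x)) ^ (2 : ℝ) ∂μ) ^ (1 / 2 : ℝ)
        * (∫⁻ x, ENNReal.ofReal (Real.exp (g x)) ^ (2 : ℝ) ∂μ) ^ (1 / 2 : ℝ) :=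
      ENNReal.lintegral_mul_le_Lp_mul_Lq μ Real.HolderConjugate.two_two
        (by fun_prop) (by fun_prop)
    _ ≤ ENNReal.ofReal (Real.exp (2 * s)) ^ (1 / 2 : ℝ)
        * ENNReal.ofReal (Real.exp (2 * t)) ^ (1 / 2 : ℝ) := by
      simp only [hsq]
      gcongr
    _ = ENNReal.ofReal (Real.exp (s + t)) := by
      rw [hsqrt, hsqrt, ← ENNReal.ofReal_mul (Real.exp_pos s).le, Real.exp_add]

theorem lintegral_ofReal_exp_le {α : Type*} [MeasurableSpace α] {μ : Measure α} {f : α → ℝ}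
    {r : ℝ} (hf : Integrable (fun x => Real.exp (f x)) μ)
    (hr : ∫ x, Real.exp (f x) ∂μ ≤ Real.exp r) :
    ∫⁻ x, ENNReal.ofReal (Real.exp (f x)) ∂μ ≤ ENNReal.ofReal (Real.exp r) := by
  rw [← ofReal_integral_eq_lintegral_ofReal hf (ae_of_all _ fun x => (Real.exp_pos _).le)]
  exact ENNReal.ofReal_le_ofReal hr

end ExponentialMoments

/-- A law on the line with mean zero, unit variance and sub-Gaussian norm at most `m`. Asking for
`1 ≤ m` bounds each power of `m` by the higher ones. -/
structure IsStdSubGaussian (μ : Measure ℝ) (m : ℝ) : Prop where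
  one_le : 1 ≤ m
  integrable_exp : Integrable (fun x : ℝ => Real.exp (x ^ 2 / m ^ 2)) μ
  integral_exp_le : ∫ x, Real.exp (x ^ 2 / m ^ 2) ∂μ ≤ 2
  integral_id : ∫ x, x ∂μ = 0
  integral_sq : ∫ x, x ^ 2 ∂μ = 1

namespace IsStdSubGaussian

variable {μ : Measure ℝ} {m : ℝ}

theorem integrable_of_abs_le (h : IsStdSubGaussian μ m) {f : ℝ → ℝ} (hf : Continuous f) (c : ℝ)
    (hfc : ∀ x, |f x| ≤ c * Real.exp (x ^ 2 / m ^ 2)) : Integrable f μ :=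
  (h.integrable_exp.const_mul c).mono' hf.aestronglyMeasurable (ae_of_all _ hfc)

theorem integrable_exp_mul (h : IsStdSubGaussian μ m) (t : ℝ) :
    Integrable (fun x : ℝ => Real.exp (t * x)) μ := by
  have hm := h.one_le
  refine h.integrable_of_abs_le (by fun_prop) (Real.exp (t ^ 2 * m ^ 2)) fun x => ?_
  have hsplit : t * x = (t * m) * (x / m) := by field_simp
  rw [abs_of_pos (Real.exp_pos _), ← Real.exp_add, Real.exp_le_exp, hsplit, ← mul_pow, ← div_pow]
  nlinarith [sq_nonneg (t * m - x / m), sq_nonneg (t * m), sq_nonneg (x / m)]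

theorem integrable_exp_mul_sq (h : IsStdSubGaussian μ m) {a : ℝ} (ha : a * m ^ 2 ≤ 1) :
    Integrable (fun x : ℝ => Real.exp (a * x ^ 2)) μ := by
  have hm := h.one_le
  refine h.integrable_of_abs_le (by fun_prop) 1 fun x => ?_
  rw [abs_of_pos (Real.exp_pos _), one_mul, Real.exp_le_exp, le_div_iff₀ (by positivity)]
  nlinarith [sq_nonneg x]

theorem integrable_id (h : IsStdSubGaussian μ m) : Integrable (fun x : ℝ => x) μ := by
  have hm := h.one_le
  refine h.integrable_of_abs_le (by fun_prop) m fun x => ?_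
  have hexp := Real.add_one_le_exp (x ^ 2 / m ^ 2)
  calc |x| ≤ m * (x ^ 2 / m ^ 2 + 1) := by
        rw [← sq_abs x]
        field_simp
        nlinarith [sq_nonneg (|x| - m), abs_nonneg x]
    _ ≤ m * Real.exp (x ^ 2 / m ^ 2) := by gcongr

theorem integrable_pow_four (h : IsStdSubGaussian μ m) : Integrable (fun x : ℝ => x ^ 4) μ := by
  refine h.integrable_of_abs_le (by fun_prop) (2 * m ^ 4) fun x => ?_
  rw [abs_of_nonneg (by positivity)]
  exact pow_four_le_exp_sq (zero_lt_one.trans_le h.one_le).ne' x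

theorem integral_pow_four_le (h : IsStdSubGaussian μ m) : ∫ x, x ^ 4 ∂μ ≤ 4 * m ^ 4 :=
  calc ∫ x, x ^ 4 ∂μ ≤ ∫ x, 2 * m ^ 4 * Real.exp (x ^ 2 / m ^ 2) ∂μ :=
        integral_mono h.integrable_pow_four (h.integrable_exp.const_mul _)
          (pow_four_le_exp_sq (zero_lt_one.trans_le h.one_le).ne')
    _ = 2 * m ^ 4 * ∫ x, Real.exp (x ^ 2 / m ^ 2) ∂μ := integral_const_mul _ _
    _ ≤ 2 * m ^ 4 * 2 := by gcongr; exact h.integral_exp_le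
    _ = 4 * m ^ 4 := by ring

variable [IsProbabilityMeasure μ]

theorem integral_exp_mul_sq_le (h : IsStdSubGaussian μ m) {a : ℝ} (ha : 0 ≤ a)
    (ha' : a * m ^ 2 ≤ 1) : ∫ x, Real.exp (a * x ^ 2) ∂μ ≤ Real.exp (a * m ^ 2) := by
  have hm := h.one_le
  have hconvex (x : ℝ) : Real.exp (a * x ^ 2) ≤
      1 - a * m ^ 2 + a * m ^ 2 * Real.exp (x ^ 2 / m ^ 2) := by
    have := exp_mul_le_one_add_mul (s := a * m ^ 2) (by positivity) ha' (x ^ 2 / m ^ 2)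
    rw [show a * m ^ 2 * (x ^ 2 / m ^ 2) = a * x ^ 2 by field_simp] at this
    linarith
  have hexp := h.integrable_exp.const_mul (a * m ^ 2)
  calc ∫ x, Real.exp (a * x ^ 2) ∂μ
      ≤ ∫ x, (1 - a * m ^ 2 + a * m ^ 2 * Real.exp (x ^ 2 / m ^ 2)) ∂μ :=
        integral_mono (h.integrable_exp_mul_sq ha') ((integrable_const _).add hexp) hconvex
    _ = 1 - a * m ^ 2 + a * m ^ 2 * ∫ x, Real.exp (x ^ 2 / m ^ 2) ∂μ := by
        rw [integral_add (integrable_const _) hexp, integral_const_mul]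
        simp
    _ ≤ 1 - a * m ^ 2 + a * m ^ 2 * 2 := by gcongr; exact h.integral_exp_le
    _ ≤ Real.exp (a * m ^ 2) := by linarith [Real.add_one_le_exp (a * m ^ 2)]

/- For `t² m² ≤ 1` the linear term of `exp (t x)` integrates to zero; for larger `t`, `t x` is
absorbed by a multiple of `x²`. -/
theorem integral_exp_mul_le (h : IsStdSubGaussian μ m) (t : ℝ) :
    ∫ x, Real.exp (t * x) ∂μ ≤ Real.exp (t ^ 2 * m ^ 2) := by
  have hm := h.one_le
  rcases le_total (t ^ 2 * m ^ 2) 1 with ht | ht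
  · have hlin := h.integrable_id.const_mul t
    have hsq := h.integrable_exp_mul_sq ht
    calc ∫ x, Real.exp (t * x) ∂μ ≤ ∫ x, (t * x + Real.exp (t ^ 2 * x ^ 2)) ∂μ :=
          integral_mono (h.integrable_exp_mul t) (hlin.add hsq) fun x => by
            simpa only [mul_pow] using exp_le_add_exp_sq (t * x)
      _ = ∫ x, Real.exp (t ^ 2 * x ^ 2) ∂μ := by
          rw [integral_add hlin hsq, integral_const_mul, h.integral_id, mul_zero, zero_add]
      _ ≤ Real.exp (t ^ 2 * m ^ 2) := h.integral_exp_mul_sq_le (sq_nonneg t) ht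
  · have hhalf : 1 / (2 * m ^ 2) * m ^ 2 = 1 / 2 := by field_simp
    have hsq := h.integrable_exp_mul_sq (a := 1 / (2 * m ^ 2)) (by rw [hhalf]; norm_num)
    have hamgm (x : ℝ) : t * x ≤ t ^ 2 * m ^ 2 / 2 + 1 / (2 * m ^ 2) * x ^ 2 := by
      have htx : t * x = (t * m) * (x / m) := by field_simp
      have hx : 1 / (2 * m ^ 2) * x ^ 2 = (x / m) ^ 2 / 2 := by field_simp
      rw [htx, hx, ← mul_pow]
      nlinarith [sq_nonneg (t * m - x / m)]
    calc ∫ x, Real.exp (t * x) ∂μ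
        ≤ ∫ x, Real.exp (t ^ 2 * m ^ 2 / 2) * Real.exp (1 / (2 * m ^ 2) * x ^ 2) ∂μ :=
          integral_mono (h.integrable_exp_mul t) (hsq.const_mul _) fun x => by
            simpa only [← Real.exp_add, Real.exp_le_exp] using hamgm x
      _ = Real.exp (t ^ 2 * m ^ 2 / 2) * ∫ x, Real.exp (1 / (2 * m ^ 2) * x ^ 2) ∂μ :=
          integral_const_mul _ _
      _ ≤ Real.exp (t ^ 2 * m ^ 2 / 2) * Real.exp (1 / 2) := by
          gcongr
          exact (h.integral_exp_mul_sq_le (by positivity) (by rw [hhalf]; norm_num)).trans_eq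
            (by rw [hhalf])
      _ ≤ Real.exp (t ^ 2 * m ^ 2) := by
          rw [← Real.exp_add, Real.exp_le_exp]
          linarith

theorem integral_exp_neg_mul_sq_le (h : IsStdSubGaussian μ m) {a : ℝ} (ha : 0 ≤ a)
    (ha' : a * (16 * m ^ 4) ≤ 1) : ∫ x, Real.exp (-(2 * a) * x ^ 2) ∂μ ≤ Real.exp (-a) := by
  have hsq : Integrable (fun x : ℝ => x ^ 2) μ := integrable_of_integral_eq_one h.integral_sq
  have hlin : Integrable (fun x : ℝ => 1 - 2 * a * x ^ 2) μ :=
    (integrable_const 1).sub (hsq.const_mul (2 * a))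
  have hquad := h.integrable_pow_four.const_mul (2 * a ^ 2)
  calc ∫ x, Real.exp (-(2 * a) * x ^ 2) ∂μ
      ≤ ∫ x, (1 - 2 * a * x ^ 2 + 2 * a ^ 2 * x ^ 4) ∂μ :=
        integral_mono (h.integrable_exp_mul_sq (by nlinarith [sq_nonneg m])) (hlin.add hquad)
          fun x => (congrArg Real.exp (neg_mul _ _)).trans_le
            ((exp_neg_le_one_sub_add_sq (by positivity)).trans_eq (by ring))
    _ = 1 - 2 * a + 2 * a ^ 2 * ∫ x, x ^ 4 ∂μ := by
        rw [integral_add hlin hquad, integral_sub (integrable_const _) (hsq.const_mul _),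
          integral_const_mul, integral_const_mul, h.integral_sq]
        simp
    _ ≤ 1 - 2 * a + 2 * a ^ 2 * (4 * m ^ 4) := by gcongr; exact h.integral_pow_four_le
    _ = 1 - 2 * a + a * (a * (16 * m ^ 4)) / 2 := by ring
    _ ≤ -a + 1 := by nlinarith
    _ ≤ Real.exp (-a) := Real.add_one_le_exp (-a)

theorem lintegral_exp_neg_quadratic_le (h : IsStdSubGaussian μ m) {a : ℝ} (ha : 0 ≤ a)
    (ha' : a * (16 * m ^ 4) ≤ 1) (b : ℝ) :
    ∫⁻ x, ENNReal.ofReal (Real.exp (-(a * x ^ 2 + 2 * b * x))) ∂μ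
      ≤ ENNReal.ofReal (Real.exp (-(a / 2) + 8 * m ^ 2 * b ^ 2)) := by
  have hsq := lintegral_ofReal_exp_le (h.integrable_exp_mul_sq (by nlinarith [sq_nonneg m]))
    (h.integral_exp_neg_mul_sq_le ha ha')
  have hlin := lintegral_ofReal_exp_le (h.integrable_exp_mul (-4 * b))
    (h.integral_exp_mul_le (-4 * b))
  refine (lintegral_congr fun x => ?_).trans_le
    (lintegral_exp_add_le (f := fun x => -a * x ^ 2) (g := fun x => -2 * b * x)
      (by fun_prop) (by fun_prop) ?_ ?_)
  · ring_nf
  · convert hsq using 3 <;> ring_nf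
  · convert hlin using 3 <;> ring_nf

theorem lintegral_exp_quadratic_le (h : IsStdSubGaussian μ m) {a : ℝ} (ha : 0 ≤ a)
    (ha' : a * (16 * m ^ 4) ≤ 1) (b : ℝ) :
    ∫⁻ x, ENNReal.ofReal (Real.exp (a * x ^ 2 + 2 * b * x)) ∂μ
      ≤ ENNReal.ofReal (Real.exp (m ^ 2 * a + 8 * m ^ 2 * b ^ 2)) := by
  have ham : 2 * a * m ^ 2 ≤ 1 := by
    have : m ^ 2 ≤ m ^ 4 := pow_le_pow_right₀ h.one_le (by norm_num)
    nlinarith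
  have hsq := lintegral_ofReal_exp_le (h.integrable_exp_mul_sq ham)
    (h.integral_exp_mul_sq_le (by positivity) ham)
  have hlin := lintegral_ofReal_exp_le (h.integrable_exp_mul (4 * b))
    (h.integral_exp_mul_le (4 * b))
  refine lintegral_exp_add_le (f := fun x => a * x ^ 2) (g := fun x => 2 * b * x)
      (by fun_prop) (by fun_prop) ?_ ?_
  · convert hsq using 3 <;> ring_nf
  · convert hlin using 3 <;> ring_nf

end IsStdSubGaussian

/-! ### Squared norms of random combinations of vectors -/

section Elimination

variable {F : Type*} [NormedAddCommGroup F] [InnerProductSpace ℝ F]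

theorem norm_add_smul_inner_sq (c : ℝ) (e w : F) :
    ‖w + (c * inner ℝ e w) • e‖ ^ 2 = ‖w‖ ^ 2 + (2 * c + c ^ 2 * ‖e‖ ^ 2) * inner ℝ e w ^ 2 := by
  rw [norm_add_sq_real, norm_smul, mul_pow, Real.norm_eq_abs, sq_abs, real_inner_smul_right,
    real_inner_comm e w]
  ring

theorem sum_smul_add_smul_inner {ι : Type*} [Fintype ι] (c : ℝ) (e : F) (v : ι → F) (x : ι → ℝ) :
    ∑ i, x i • (v i + (c * inner ℝ e (v i)) • e)
      = ∑ i, x i • v i + (c * inner ℝ e (∑ i, x i • v i)) • e := by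
  simp only [smul_add, Finset.sum_add_distrib, inner_sum, real_inner_smul_right, Finset.mul_sum,
    Finset.sum_smul, smul_smul]
  congr! 3
  ring

theorem sum_inner_sq_le {ι : Type*} [Fintype ι] {g : ℝ} (hg : 0 ≤ g) {v : ι → F}
    (hv : ∀ x : ι → ℝ, ‖∑ i, x i • v i‖ ^ 2 ≤ g * ∑ i, x i ^ 2) (e : F) :
    ∑ i, inner ℝ e (v i) ^ 2 ≤ g * ‖e‖ ^ 2 := by
  set s := ∑ i, inner ℝ e (v i) ^ 2 with hs
  set w := ∑ i, inner ℝ e (v i) • v i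
  have hew : inner ℝ e w = s := by
    simp only [w, inner_sum, real_inner_smul_right, hs, sq]
  have hw : ‖w‖ ^ 2 ≤ g * s := hv _
  have hcs : s ^ 2 ≤ ‖e‖ ^ 2 * ‖w‖ ^ 2 := by
    rw [← hew, ← mul_pow, sq_le_sq, abs_mul, abs_norm, abs_norm]
    exact abs_real_inner_le_norm e w
  rcases (show 0 ≤ s by positivity).eq_or_lt with hs0 | hs0
  · rw [← hs0]
    positivity
  · nlinarith [mul_le_mul_of_nonneg_left hw (sq_nonneg ‖e‖)]

theorem norm_sum_cons_smul_sq {N : ℕ} (v : Fin (N + 1) → F) (x₀ : ℝ) (x : Fin N → ℝ) :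
    ‖∑ i, (Fin.cons x₀ x : Fin (N + 1) → ℝ) i • v i‖ ^ 2 = ‖v 0‖ ^ 2 * x₀ ^ 2
      + 2 * inner ℝ (v 0) (∑ j, x j • v j.succ) * x₀ + ‖∑ j, x j • v j.succ‖ ^ 2 := by
  simp only [Fin.sum_univ_succ, Fin.cons_zero, Fin.cons_succ]
  rw [norm_add_sq_real, norm_smul, mul_pow, Real.norm_eq_abs, sq_abs, real_inner_smul_left]
  ring

theorem norm_sum_succ_smul_sq_le {N : ℕ} {g : ℝ} {v : Fin (N + 1) → F}
    (hv : ∀ x : Fin (N + 1) → ℝ, ‖∑ i, x i • v i‖ ^ 2 ≤ g * ∑ i, x i ^ 2) (x : Fin N → ℝ) :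
    ‖∑ j, x j • v j.succ‖ ^ 2 ≤ g * ∑ j, x j ^ 2 := by
  simpa [Fin.sum_univ_succ] using hv (Fin.cons 0 x)

theorem norm_apply_zero_sq_le {N : ℕ} {g : ℝ} {v : Fin (N + 1) → F}
    (hv : ∀ x : Fin (N + 1) → ℝ, ‖∑ i, x i • v i‖ ^ 2 ≤ g * ∑ i, x i ^ 2) : ‖v 0‖ ^ 2 ≤ g := by
  simpa [Fin.sum_univ_succ] using hv (Fin.cons 1 0)

end Elimination

section ExpNormSq

variable {F : Type*} [NormedAddCommGroup F] [InnerProductSpace ℝ F]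

theorem lintegral_pi_fin_succ {N : ℕ} (μ : Fin (N + 1) → Measure ℝ)
    [∀ i, IsProbabilityMeasure (μ i)] {f : (Fin (N + 1) → ℝ) → ℝ≥0∞} (hf : Measurable f) :
    ∫⁻ x, f x ∂Measure.pi μ
      = ∫⁻ x, ∫⁻ x₀, f (Fin.cons x₀ x) ∂(μ 0) ∂(Measure.pi fun i : Fin N => μ i.succ) := by
  rw [← (measurePreserving_piFinSuccAbove μ 0).symm.lintegral_comp hf]
  simp only [Fin.succAbove_zero]
  rw [lintegral_prod_symm _ (by fun_prop)]
  simp [MeasurableEquiv.piFinSuccAbove, Fin.insertNthEquiv]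

theorem measurable_norm_sum_smul {ι : Type*} [Fintype ι] (v : ι → F) :
    Measurable fun x : ι → ℝ => ‖∑ i, x i • v i‖ :=
  Continuous.measurable (by fun_prop)

/- Integrating out the coordinate `x 0` of a quadratic form costs at most `L ⟪v 0, w⟫ ^ 2`, where
`w` is the contribution of the other coordinates. Perturbing the other vectors along `v 0` absorbs
this term. -/
theorem lintegral_exp_norm_sq_succ_le {N : ℕ} {σ θ L : ℝ} {μ : Fin (N + 1) → Measure ℝ}
    [∀ i, IsProbabilityMeasure (μ i)] {v : Fin (N + 1) → F} {v' : Fin N → F}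
    (hμ : ∀ b : ℝ, ∫⁻ x, ENNReal.ofReal (Real.exp (σ * (‖v 0‖ ^ 2 * x ^ 2 + 2 * b * x))) ∂(μ 0)
      ≤ ENNReal.ofReal (Real.exp (θ + L * b ^ 2)))
    (hv' : ∀ x : Fin N → ℝ,
      σ * ‖∑ j, x j • v j.succ‖ ^ 2 + L * inner ℝ (v 0) (∑ j, x j • v j.succ) ^ 2
        ≤ σ * ‖∑ j, x j • v' j‖ ^ 2) :
    ∫⁻ x, ENNReal.ofReal (Real.exp (σ * ‖∑ i, x i • v i‖ ^ 2)) ∂(Measure.pi μ)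
      ≤ ENNReal.ofReal (Real.exp θ) * ∫⁻ x, ENNReal.ofReal (Real.exp (σ * ‖∑ j, x j • v' j‖ ^ 2))
          ∂(Measure.pi fun i : Fin N => μ i.succ) := by
  have hmeas := measurable_norm_sum_smul v
  have hmeas' := measurable_norm_sum_smul v'
  rw [lintegral_pi_fin_succ μ (by fun_prop), ← lintegral_const_mul _ (by fun_prop)]
  refine lintegral_mono fun x => ?_
  set w := ∑ j, x j • v j.succ
  calc ∫⁻ x₀, ENNReal.ofReal (Real.exp
        (σ * ‖∑ i, (Fin.cons x₀ x : Fin (N + 1) → ℝ) i • v i‖ ^ 2)) ∂(μ 0)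
      = ∫⁻ x₀, ENNReal.ofReal (Real.exp (σ * ‖w‖ ^ 2)) * ENNReal.ofReal (Real.exp
          (σ * (‖v 0‖ ^ 2 * x₀ ^ 2 + 2 * inner ℝ (v 0) w * x₀))) ∂(μ 0) := by
        refine lintegral_congr fun x₀ => ?_
        rw [← ENNReal.ofReal_mul (Real.exp_pos _).le, ← Real.exp_add, norm_sum_cons_smul_sq]
        congr 2
        ring
    _ ≤ ENNReal.ofReal (Real.exp (σ * ‖w‖ ^ 2))
        * ENNReal.ofReal (Real.exp (θ + L * inner ℝ (v 0) w ^ 2)) := by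
        rw [lintegral_const_mul _ (by fun_prop)]
        gcongr
        exact hμ _
    _ ≤ ENNReal.ofReal (Real.exp θ) * ENNReal.ofReal (Real.exp (σ * ‖∑ j, x j • v' j‖ ^ 2)) := by
        simp only [← ENNReal.ofReal_mul (Real.exp_pos _).le, ← Real.exp_add]
        exact ENNReal.ofReal_le_ofReal (Real.exp_le_exp.2 (by linarith [hv' x]))

theorem lintegral_exp_neg_norm_sq_le {g L : ℝ} (hg : 0 ≤ g) (hL : 0 ≤ L) (hLg : L * g ≤ 1 / 2)
    {N : ℕ} (μ : Fin N → Measure ℝ) [∀ i, IsProbabilityMeasure (μ i)]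
    (hμ : ∀ i, ∀ a b : ℝ, 0 ≤ a → a ≤ g →
      ∫⁻ x, ENNReal.ofReal (Real.exp (-(a * x ^ 2 + 2 * b * x))) ∂(μ i)
        ≤ ENNReal.ofReal (Real.exp (-(a / 2) + L * b ^ 2)))
    (v : Fin N → F) (hv : ∀ x : Fin N → ℝ, ‖∑ i, x i • v i‖ ^ 2 ≤ g * ∑ i, x i ^ 2) :
    ∫⁻ x, ENNReal.ofReal (Real.exp (-‖∑ i, x i • v i‖ ^ 2)) ∂(Measure.pi μ)
      ≤ ENNReal.ofReal (Real.exp (-((∑ i, ‖v i‖ ^ 2) / 4))) := by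
  induction N with
  | zero => simp
  | succ N ih =>
    set a := ‖v 0‖ ^ 2 with ha
    have ha0 : 0 ≤ a := sq_nonneg _
    have hag : a ≤ g := norm_apply_zero_sq_le hv
    have hLa : L * a ≤ 1 / 2 := (mul_le_mul_of_nonneg_left hag hL).trans hLg
    set v' : Fin N → F := fun j => v j.succ + (-L * inner ℝ (v 0) (v j.succ)) • v 0 with hv'
    have hdrop (s : ℝ) : (2 * -L + (-L) ^ 2 * a) * s ^ 2 ≤ -L * s ^ 2 := by
      nlinarith [mul_nonneg (mul_nonneg hL (sub_nonneg.2 hLa)) (sq_nonneg s),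
        mul_nonneg hL (sq_nonneg s)]
    have hcomb (x : Fin N → ℝ) : ‖∑ j, x j • v' j‖ ^ 2 ≤ ‖∑ j, x j • v j.succ‖ ^ 2
        - L * inner ℝ (v 0) (∑ j, x j • v j.succ) ^ 2 := by
      rw [hv', sum_smul_add_smul_inner, norm_add_smul_inner_sq]
      linarith [hdrop (inner ℝ (v 0) (∑ j, x j • v j.succ))]
    have hbound (x : Fin N → ℝ) : ‖∑ j, x j • v' j‖ ^ 2 ≤ g * ∑ j, x j ^ 2 := by
      have := mul_nonneg hL (sq_nonneg (inner ℝ (v 0) (∑ j, x j • v j.succ)))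
      linarith [hcomb x, norm_sum_succ_smul_sq_le hv x]
    have htrace : ∑ i, ‖v i‖ ^ 2 - 2 * a ≤ ∑ j, ‖v' j‖ ^ 2 := by
      have hinner := sum_inner_sq_le hg (norm_sum_succ_smul_sq_le hv) (v 0)
      simp only [hv', norm_add_smul_inner_sq, Finset.sum_add_distrib, ← Finset.mul_sum,
        Fin.sum_univ_succ (n := N), ← ha] at hinner ⊢
      nlinarith [mul_nonneg (sq_nonneg L) ha0,
        show 0 ≤ ∑ j : Fin N, inner ℝ (v 0) (v j.succ) ^ 2 by positivity]
    have hstep := lintegral_exp_norm_sq_succ_le (σ := -1) (θ := -(a / 2)) (L := L) (μ := μ)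
      (v := v) (v' := v') (fun b => by simpa only [neg_one_mul] using hμ 0 a b ha0 hag)
      (fun x => by linarith [hcomb x])
    simp only [neg_one_mul] at hstep
    calc ∫⁻ x, ENNReal.ofReal (Real.exp (-‖∑ i, x i • v i‖ ^ 2)) ∂(Measure.pi μ)
        ≤ ENNReal.ofReal (Real.exp (-(a / 2)))
          * ENNReal.ofReal (Real.exp (-((∑ j, ‖v' j‖ ^ 2) / 4))) :=
          hstep.trans (by gcongr; exact ih _ (fun i => hμ i.succ) v' hbound)
      _ ≤ ENNReal.ofReal (Real.exp (-((∑ i, ‖v i‖ ^ 2) / 4))) := by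
          rw [← ENNReal.ofReal_mul (Real.exp_pos _).le, ← Real.exp_add]
          exact ENNReal.ofReal_le_ofReal (Real.exp_le_exp.2 (by linarith))

theorem lintegral_exp_norm_sq_le {g L κ : ℝ} (hg : 0 ≤ g) (hL : 0 ≤ L) (hLg : L * g ≤ 1 / 2)
    (hκ : 0 ≤ κ) {N : ℕ} (μ : Fin N → Measure ℝ) [∀ i, IsProbabilityMeasure (μ i)]
    (hμ : ∀ i, ∀ a b : ℝ, 0 ≤ a → a ≤ g →
      ∫⁻ x, ENNReal.ofReal (Real.exp (a * x ^ 2 + 2 * b * x)) ∂(μ i)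
        ≤ ENNReal.ofReal (Real.exp (κ * a + L * b ^ 2)))
    (v : Fin N → F) (hv : ∀ x : Fin N → ℝ, ‖∑ i, x i • v i‖ ^ 2 ≤ g * ∑ i, x i ^ 2) :
    ∫⁻ x, ENNReal.ofReal (Real.exp (‖∑ i, x i • v i‖ ^ 2)) ∂(Measure.pi μ)
      ≤ ENNReal.ofReal (Real.exp (3 * κ * ∑ i, ‖v i‖ ^ 2)) := by
  induction N with
  | zero => simp
  | succ N ih =>
    set a := ‖v 0‖ ^ 2 with ha
    have ha0 : 0 ≤ a := sq_nonneg _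
    have hag : a ≤ g := norm_apply_zero_sq_le hv
    set v' : Fin N → F := fun j => v j.succ + (L / 2 * inner ℝ (v 0) (v j.succ)) • v 0 with hv'
    have hcomb (x : Fin N → ℝ) : ‖∑ j, x j • v' j‖ ^ 2 = ‖∑ j, x j • v j.succ‖ ^ 2
        + (L + L ^ 2 * a / 4) * inner ℝ (v 0) (∑ j, x j • v j.succ) ^ 2 := by
      rw [hv', sum_smul_add_smul_inner, norm_add_smul_inner_sq]
      ring
    have hbound (x : Fin N → ℝ) : ‖∑ j, x j • v' j‖ ^ 2 ≤ g * ∑ j, x j ^ 2 := by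
      set s := inner ℝ (v 0) (∑ j, x j • v j.succ)
      have hcons := hv (Fin.cons (L * s) x)
      rw [norm_sum_cons_smul_sq] at hcons
      simp only [Fin.sum_univ_succ, Fin.cons_zero, Fin.cons_succ] at hcons
      rw [hcomb x]
      nlinarith [mul_nonneg (mul_nonneg hL (sub_nonneg.2 hLg)) (sq_nonneg s),
        mul_nonneg ha0 (sq_nonneg (L * s))]
    have htrace : ∑ j, ‖v' j‖ ^ 2 ≤ ∑ i, ‖v i‖ ^ 2 - 7 / 16 * a := by
      have hinner := sum_inner_sq_le hg (norm_sum_succ_smul_sq_le hv) (v 0)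
      simp only [hv', norm_add_smul_inner_sq, Finset.sum_add_distrib, ← Finset.mul_sum,
        Fin.sum_univ_succ (n := N), ← ha] at hinner ⊢
      have hLa : L * a ≤ 1 / 2 := (mul_le_mul_of_nonneg_left hag hL).trans hLg
      have hLs := mul_le_mul_of_nonneg_left hinner hL
      have hLga := mul_le_mul_of_nonneg_right hLg ha0
      have hLas := mul_le_mul_of_nonneg_right hLa
        (mul_nonneg hL (show 0 ≤ ∑ j : Fin N, inner ℝ (v 0) (v j.succ) ^ 2 by positivity))
      nlinarith
    have hstep := lintegral_exp_norm_sq_succ_le (σ := 1) (θ := κ * a) (L := L) (μ := μ)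
      (v := v) (v' := v') (fun b => by simpa only [one_mul] using hμ 0 a b ha0 hag)
      (fun x => by
        have := mul_nonneg (mul_nonneg (sq_nonneg L) ha0)
          (sq_nonneg (inner ℝ (v 0) (∑ j, x j • v j.succ)))
        linarith [hcomb x])
    simp only [one_mul] at hstep
    calc ∫⁻ x, ENNReal.ofReal (Real.exp (‖∑ i, x i • v i‖ ^ 2)) ∂(Measure.pi μ)
        ≤ ENNReal.ofReal (Real.exp (κ * a))
          * ENNReal.ofReal (Real.exp (3 * κ * ∑ j, ‖v' j‖ ^ 2)) :=
          hstep.trans (by gcongr; exact ih _ (fun i => hμ i.succ) v' hbound)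
      _ ≤ ENNReal.ofReal (Real.exp (3 * κ * ∑ i, ‖v i‖ ^ 2)) := by
          rw [← ENNReal.ofReal_mul (Real.exp_pos _).le, ← Real.exp_add]
          refine ENNReal.ofReal_le_ofReal (Real.exp_le_exp.2 ?_)
          nlinarith [mul_le_mul_of_nonneg_left htrace hκ, mul_nonneg hκ ha0]

end ExpNormSq

section Tail

variable {Ω ι : Type*} [MeasurableSpace Ω] {P : Measure Ω} {ξ : ι → Ω → ℝ}

theorem lintegral_comp_eq_lintegral_pi_map {κ : Type*} [Fintype κ] [IsProbabilityMeasure P]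
    (hξ : iIndepFun ξ P) (hmeas : ∀ i, AEMeasurable (ξ i) P) {e : κ → ι}
    (he : Function.Injective e) {f : (κ → ℝ) → ℝ≥0∞} (hf : Measurable f) :
    ∫⁻ ω, f (fun k => ξ (e k) ω) ∂P = ∫⁻ x, f x ∂(Measure.pi fun k => P.map (ξ (e k))) := by
  rw [← (hξ.precomp he).map_fun_eq_pi_map fun k => hmeas (e k),
    lintegral_map' hf.aemeasurable (aemeasurable_pi_lambda _ fun k => hmeas (e k))]

theorem measure_le_of_lintegral_exp_le {f : Ω → ℝ} (hf : AEMeasurable f P) {s : ℝ} (t : ℝ)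
    (h : ∫⁻ ω, ENNReal.ofReal (Real.exp (f ω)) ∂P ≤ ENNReal.ofReal (Real.exp s)) :
    P {ω | t ≤ f ω} ≤ ENNReal.ofReal (Real.exp (s - t)) := by
  calc P {ω | t ≤ f ω}
      ≤ P {ω | ENNReal.ofReal (Real.exp t) ≤ ENNReal.ofReal (Real.exp (f ω))} :=
        measure_mono fun ω hω => ENNReal.ofReal_le_ofReal (Real.exp_le_exp.2 hω)
    _ ≤ (∫⁻ ω, ENNReal.ofReal (Real.exp (f ω)) ∂P) / ENNReal.ofReal (Real.exp t) :=
        meas_ge_le_lintegral_div (by fun_prop) (by simp [Real.exp_pos]) ENNReal.ofReal_ne_top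
    _ ≤ ENNReal.ofReal (Real.exp (s - t)) := by
        rw [Real.exp_sub, ENNReal.ofReal_div_of_pos (Real.exp_pos t)]
        gcongr

variable [Fintype ι] {F : Type*} [NormedAddCommGroup F] [InnerProductSpace ℝ F] {m g : ℝ}
  {v : ι → F}

theorem aemeasurable_norm_sum_smul (hmeas : ∀ i, AEMeasurable (ξ i) P) (v : ι → F) :
    AEMeasurable (fun ω => ‖∑ i, ξ i ω • v i‖) P :=
  (measurable_norm_sum_smul v).comp_aemeasurable (aemeasurable_pi_lambda _ hmeas)

theorem lintegral_pi_map_comp_norm_sum_smul {κ : Type*} [Fintype κ] [IsProbabilityMeasure P]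
    (hξ : iIndepFun ξ P) (hmeas : ∀ i, AEMeasurable (ξ i) P) (e : κ ≃ ι) {f : ℝ → ℝ≥0∞}
    (hf : Measurable f) (v : ι → F) :
    ∫⁻ x, f ‖∑ k, x k • v (e k)‖ ∂(Measure.pi fun k => P.map (ξ (e k)))
      = ∫⁻ ω, f ‖∑ i, ξ i ω • v i‖ ∂P := by
  rw [← lintegral_comp_eq_lintegral_pi_map hξ hmeas e.injective
    (f := fun x => f ‖∑ k, x k • v (e k)‖) (hf.comp (measurable_norm_sum_smul _))]
  exact lintegral_congr fun ω => congrArg (f ‖·‖) (e.sum_comp fun i => ξ i ω • v i)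

theorem norm_sum_comp_smul_sq_le {κ : Type*} [Fintype κ]
    (hv : ∀ x : ι → ℝ, ‖∑ i, x i • v i‖ ^ 2 ≤ g * ∑ i, x i ^ 2) (e : κ ≃ ι) (x : κ → ℝ) :
    ‖∑ k, x k • v (e k)‖ ^ 2 ≤ g * ∑ k, x k ^ 2 := by
  have := hv (x ∘ e.symm)
  rw [← e.sum_comp, ← e.sum_comp] at this
  simpa only [Function.comp_apply, e.symm_apply_apply] using this

variable [IsProbabilityMeasure P]

theorem lintegral_exp_neg_norm_sum_sq_le (hξ : iIndepFun ξ P)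
    (hmeas : ∀ i, AEMeasurable (ξ i) P) (hsub : ∀ i, IsStdSubGaussian (P.map (ξ i)) m)
    (hm : 1 ≤ m) (hv : ∀ x : ι → ℝ, ‖∑ i, x i • v i‖ ^ 2 ≤ g * ∑ i, x i ^ 2) (hg : 0 ≤ g)
    (hgm : g * (16 * m ^ 4) ≤ 1) :
    ∫⁻ ω, ENNReal.ofReal (Real.exp (-‖∑ i, ξ i ω • v i‖ ^ 2)) ∂P
      ≤ ENNReal.ofReal (Real.exp (-((∑ i, ‖v i‖ ^ 2) / 4))) := by
  set e := (Fintype.equivFin ι).symm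
  have hprob (k) : IsProbabilityMeasure (P.map (ξ (e k))) :=
    Measure.isProbabilityMeasure_map (hmeas _)
  have hmg : 8 * m ^ 2 * g ≤ 1 / 2 := by
    nlinarith [pow_le_pow_right₀ hm (show 2 ≤ 4 by norm_num)]
  rw [← lintegral_pi_map_comp_norm_sum_smul hξ hmeas e
    (f := fun r => ENNReal.ofReal (Real.exp (-r ^ 2))) (by fun_prop),
    ← e.sum_comp fun i => ‖v i‖ ^ 2]
  exact lintegral_exp_neg_norm_sq_le hg (by positivity) hmg _
    (fun k a b ha hag => (hsub (e k)).lintegral_exp_neg_quadratic_le ha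
      ((mul_le_mul_of_nonneg_right hag (by positivity)).trans hgm) b) _
    (norm_sum_comp_smul_sq_le hv e)

theorem lintegral_exp_norm_sum_sq_le (hξ : iIndepFun ξ P)
    (hmeas : ∀ i, AEMeasurable (ξ i) P) (hsub : ∀ i, IsStdSubGaussian (P.map (ξ i)) m)
    (hm : 1 ≤ m) (hv : ∀ x : ι → ℝ, ‖∑ i, x i • v i‖ ^ 2 ≤ g * ∑ i, x i ^ 2) (hg : 0 ≤ g)
    (hgm : g * (16 * m ^ 4) ≤ 1) :
    ∫⁻ ω, ENNReal.ofReal (Real.exp (‖∑ i, ξ i ω • v i‖ ^ 2)) ∂P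
      ≤ ENNReal.ofReal (Real.exp (3 * m ^ 2 * ∑ i, ‖v i‖ ^ 2)) := by
  set e := (Fintype.equivFin ι).symm
  have hprob (k) : IsProbabilityMeasure (P.map (ξ (e k))) :=
    Measure.isProbabilityMeasure_map (hmeas _)
  have hmg : 8 * m ^ 2 * g ≤ 1 / 2 := by
    nlinarith [pow_le_pow_right₀ hm (show 2 ≤ 4 by norm_num)]
  rw [← lintegral_pi_map_comp_norm_sum_smul hξ hmeas e
    (f := fun r => ENNReal.ofReal (Real.exp (r ^ 2))) (by fun_prop),
    ← e.sum_comp fun i => ‖v i‖ ^ 2]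
  exact lintegral_exp_norm_sq_le hg (by positivity) hmg (by positivity) _
    (fun k a b ha hag => (hsub (e k)).lintegral_exp_quadratic_le ha
      ((mul_le_mul_of_nonneg_right hag (by positivity)).trans hgm) b) _
    (norm_sum_comp_smul_sq_le hv e)

theorem norm_sum_smul_smul_sq (c : ℝ) (v : ι → F) (x : ι → ℝ) :
    ‖∑ i, x i • c • v i‖ ^ 2 = c ^ 2 * ‖∑ i, x i • v i‖ ^ 2 := by
  simp only [smul_comm _ c, ← Finset.smul_sum, norm_smul, mul_pow, Real.norm_eq_abs, sq_abs]

theorem sum_norm_smul_sq (c : ℝ) (v : ι → F) :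
    ∑ i, ‖c • v i‖ ^ 2 = c ^ 2 * ∑ i, ‖v i‖ ^ 2 := by
  simp only [norm_smul, mul_pow, Real.norm_eq_abs, sq_abs, Finset.mul_sum]

theorem measure_norm_sum_sq_le (hξ : iIndepFun ξ P) (hmeas : ∀ i, AEMeasurable (ξ i) P)
    (hsub : ∀ i, IsStdSubGaussian (P.map (ξ i)) m) (hm : 1 ≤ m) (hg : 0 < g)
    (hv : ∀ x : ι → ℝ, ‖∑ i, x i • v i‖ ^ 2 ≤ g * ∑ i, x i ^ 2) :
    P {ω | ‖∑ i, ξ i ω • v i‖ ^ 2 ≤ (∑ i, ‖v i‖ ^ 2) / 8}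
      ≤ ENNReal.ofReal (Real.exp (-((∑ i, ‖v i‖ ^ 2) / (128 * m ^ 4 * g)))) := by
  set t := ∑ i, ‖v i‖ ^ 2
  set c := √(1 / (16 * m ^ 4 * g))
  have hc : c ^ 2 = 1 / (16 * m ^ 4 * g) := Real.sq_sqrt (by positivity)
  have : 0 < c ^ 2 := hc ▸ by positivity
  have hexp := lintegral_exp_neg_norm_sum_sq_le (v := fun i => c • v i) (g := c ^ 2 * g) hξ hmeas
    hsub hm (fun x => by rw [norm_sum_smul_smul_sq, mul_assoc]; gcongr; exact hv x)
    (by positivity) (by rw [hc]; field_simp; rfl)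
  rw [sum_norm_smul_sq] at hexp
  calc P {ω | ‖∑ i, ξ i ω • v i‖ ^ 2 ≤ t / 8}
      ≤ P {ω | -(c ^ 2 * (t / 8)) ≤ -‖∑ i, ξ i ω • c • v i‖ ^ 2} :=
        measure_mono fun ω hω => by
          simp only [Set.mem_ofPred_eq, norm_sum_smul_smul_sq, neg_le_neg_iff] at hω ⊢
          gcongr
    _ ≤ ENNReal.ofReal (Real.exp (-(c ^ 2 * t / 4) - -(c ^ 2 * (t / 8)))) :=
        measure_le_of_lintegral_exp_le ((aemeasurable_norm_sum_smul hmeas _).pow_const 2).neg _ hexp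
    _ = ENNReal.ofReal (Real.exp (-(t / (128 * m ^ 4 * g)))) := by
        rw [hc]
        congr 2
        field_simp
        ring

theorem measure_le_norm_sum_sq (hξ : iIndepFun ξ P) (hmeas : ∀ i, AEMeasurable (ξ i) P)
    (hsub : ∀ i, IsStdSubGaussian (P.map (ξ i)) m) (hm : 1 ≤ m) (hg : 0 < g)
    (hv : ∀ x : ι → ℝ, ‖∑ i, x i • v i‖ ^ 2 ≤ g * ∑ i, x i ^ 2) :
    P {ω | (3 * m ^ 2 + 1) * ∑ i, ‖v i‖ ^ 2 ≤ ‖∑ i, ξ i ω • v i‖ ^ 2}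
      ≤ ENNReal.ofReal (Real.exp (-((∑ i, ‖v i‖ ^ 2) / (16 * m ^ 4 * g)))) := by
  set t := ∑ i, ‖v i‖ ^ 2
  set c := √(1 / (16 * m ^ 4 * g))
  have hc : c ^ 2 = 1 / (16 * m ^ 4 * g) := Real.sq_sqrt (by positivity)
  have : 0 < c ^ 2 := hc ▸ by positivity
  have hexp := lintegral_exp_norm_sum_sq_le (v := fun i => c • v i) (g := c ^ 2 * g) hξ hmeas
    hsub hm (fun x => by rw [norm_sum_smul_smul_sq, mul_assoc]; gcongr; exact hv x)
    (by positivity) (by rw [hc]; field_simp; rfl)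
  rw [sum_norm_smul_sq] at hexp
  calc P {ω | (3 * m ^ 2 + 1) * t ≤ ‖∑ i, ξ i ω • v i‖ ^ 2}
      ≤ P {ω | c ^ 2 * ((3 * m ^ 2 + 1) * t) ≤ ‖∑ i, ξ i ω • c • v i‖ ^ 2} :=
        measure_mono fun ω hω => by
          simp only [Set.mem_ofPred_eq, norm_sum_smul_smul_sq] at hω ⊢
          gcongr
    _ ≤ ENNReal.ofReal (Real.exp (3 * m ^ 2 * (c ^ 2 * t) - c ^ 2 * ((3 * m ^ 2 + 1) * t))) :=
        measure_le_of_lintegral_exp_le ((aemeasurable_norm_sum_smul hmeas _).pow_const 2) _ hexp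
    _ = ENNReal.ofReal (Real.exp (-(t / (16 * m ^ 4 * g)))) := by
        rw [hc]
        congr 2
        field_simp
        ring

end Tail

/-! ### Nets of the unit sphere -/

section Nets

open Metric

variable {E : Type*} [NormedAddCommGroup E] [NormedSpace ℝ E]

open scoped Function in
theorem card_le_of_isSeparated [FiniteDimensional ℝ E] {ε : ℝ≥0} (hε : 0 < ε) (hε' : ε ≤ 1)
    {s : Finset E} (hs : (s : Set E) ⊆ closedBall 0 1) (hsep : IsSeparated ε (s : Set E)) :
    (s.card : ℝ) ≤ (4 / ε) ^ Module.finrank ℝ E := by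
  borelize E
  set d := Module.finrank ℝ E
  set μ : Measure E := Measure.addHaar
  have hε2 : (0 : ℝ) < ε / 2 := by positivity
  have hdisjoint : Set.Pairwise (s : Set E) (Disjoint on fun c => ball c (ε / 2 : ℝ)) := by
    refine fun c hc e he hce => ball_disjoint_ball ?_
    have : (ε : ℝ≥0∞) < edist c e := hsep hc he hce
    rw [edist_nndist, ENNReal.coe_lt_coe] at this
    rw [add_halves]
    exact this.le
  have hsubset : ⋃ c ∈ s, ball c (ε / 2 : ℝ) ⊆ ball 0 2 :=
    Set.iUnion₂_subset fun c hc => ball_subset_ball' (by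
      have : dist c 0 ≤ 1 := hs hc
      have : (ε : ℝ) ≤ 1 := hε'
      linarith)
  have hvolume : s.card * ENNReal.ofReal ((ε / 2) ^ d) * μ (ball 0 1)
      ≤ ENNReal.ofReal (2 ^ d) * μ (ball 0 1) :=
    calc s.card * ENNReal.ofReal ((ε / 2) ^ d) * μ (ball 0 1)
        = μ (⋃ c ∈ s, ball c (ε / 2)) := by
          rw [measure_biUnion_finset hdisjoint fun c _ => measurableSet_ball]
          simp only [μ.addHaar_ball_of_pos _ hε2, Finset.sum_const, nsmul_eq_mul, mul_assoc, d]
      _ ≤ μ (ball 0 2) := measure_mono hsubset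
      _ = ENNReal.ofReal (2 ^ d) * μ (ball 0 1) := μ.addHaar_ball_of_pos _ zero_lt_two
  have hcard : s.card * (ε / 2 : ℝ) ^ d ≤ 2 ^ d := by
    have := ENNReal.toReal_le_of_le_ofReal (by positivity) ((ENNReal.mul_le_mul_iff_left
      (measure_ball_pos μ 0 zero_lt_one).ne' measure_ball_lt_top.ne).1 hvolume)
    rwa [ENNReal.toReal_mul, ENNReal.toReal_natCast, ENNReal.toReal_ofReal (by positivity)] at this
  calc (s.card : ℝ) ≤ 2 ^ d / (ε / 2) ^ d := (le_div_iff₀ (by positivity)).2 hcard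
    _ = (4 / ε) ^ d := by
      rw [← div_pow]
      congr 1
      field_simp
      norm_num

theorem packingNumber_le_of_subset_closedBall [FiniteDimensional ℝ E] {ε : ℝ≥0} (hε : 0 < ε)
    (hε' : ε ≤ 1) {A : Set E} (hA : A ⊆ closedBall 0 1) :
    packingNumber ε A ≤ ⌊(4 / ε : ℝ) ^ Module.finrank ℝ E⌋₊ := by
  refine iSup_le fun C => iSup_le fun hCA => iSup_le fun hC => ?_
  by_contra! hlt
  obtain ⟨t, htC, ht⟩ := Set.exists_subset_encard_eq (Order.add_one_le_of_lt hlt)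
  have htfin : t.Finite := Set.finite_of_encard_eq_coe ht
  lift t to Finset E using htfin
  rw [Set.encard_coe_eq_coe_finsetCard] at ht
  have hcard := Nat.le_floor
    (card_le_of_isSeparated hε hε' ((htC.trans hCA).trans hA) (hC.subset htC))
  have : t.card = ⌊(4 / ε : ℝ) ^ Module.finrank ℝ E⌋₊ + 1 := by exact_mod_cast ht
  omega

theorem exists_finset_isCover [FiniteDimensional ℝ E] {ε : ℝ≥0} (hε : 0 < ε) (hε' : ε ≤ 1)
    {A : Set E} (hA : A ⊆ closedBall 0 1) :
    ∃ s : Finset E, (s.card : ℝ) ≤ (4 / ε) ^ Module.finrank ℝ E ∧ (s : Set E) ⊆ A ∧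
      IsCover ε A s := by
  have hpacking : packingNumber ε A ≠ ⊤ :=
    ((packingNumber_le_of_subset_closedBall hε hε' hA).trans_lt (ENat.natCast_lt_top _)).ne
  have hfin : (maximalSeparatedSet ε A).Finite := by
    rwa [← Set.encard_lt_top_iff, encard_maximalSeparatedSet hpacking, lt_top_iff_ne_top]
  refine ⟨hfin.toFinset, card_le_of_isSeparated hε hε' ?_ ?_, ?_, ?_⟩ <;>
    rw [hfin.coe_toFinset]
  exacts [maximalSeparatedSet_subset.trans hA, isSeparated_maximalSeparatedSet,
    maximalSeparatedSet_subset, isCover_maximalSeparatedSet hpacking]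

theorem exists_norm_sub_le_of_isCover {E : Type*} [SeminormedAddCommGroup E] {ε : ℝ≥0}
    {A s : Set E} (hs : IsCover ε A s) {x : E} (hx : x ∈ A) : ∃ c ∈ s, ‖x - c‖ ≤ ε := by
  simpa only [Set.mem_iUnion, mem_closedBall, dist_eq_norm, exists_prop]
    using isCover_iff_subset_iUnion_closedBall.1 hs hx

variable {F : Type*} [NormedAddCommGroup F] [NormedSpace ℝ F] {ε : ℝ≥0} {a b : ℝ} {s : Set E}

theorem norm_le_of_isCover_sphere (hε : ε ≤ 1 / 2) (hb : 0 ≤ b) (hs : IsCover ε (sphere 0 1) s)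
    (T : E →L[ℝ] F) (hT : ∀ c ∈ s, ‖T c‖ ≤ b) : ‖T‖ ≤ 2 * b := by
  have : (ε : ℝ) ≤ 1 / 2 := by exact_mod_cast hε
  have hsphere : ∀ x, ‖x‖ = 1 → ‖T x‖ ≤ b + ‖T‖ * ε := fun x hx => by
    obtain ⟨c, hc, hxc⟩ := exists_norm_sub_le_of_isCover hs (mem_sphere_zero_iff_norm.2 hx)
    calc ‖T x‖ = ‖T c + T (x - c)‖ := by rw [← map_add, add_sub_cancel]
      _ ≤ ‖T c‖ + ‖T (x - c)‖ := norm_add_le _ _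
      _ ≤ b + ‖T‖ * ε := add_le_add (hT c hc) (T.le_opNorm_of_le hxc)
  have hnorm : ‖T‖ ≤ b + ‖T‖ * ε := T.opNorm_le_of_unit_norm (by positivity) hsphere
  nlinarith [norm_nonneg T]

theorem le_norm_of_isCover_sphere (hs : IsCover ε (sphere 0 1) s) (T : E →L[ℝ] F)
    (hT : ∀ c ∈ s, a ≤ ‖T c‖) (x : E) : (a - ‖T‖ * ε) * ‖x‖ ≤ ‖T x‖ := by
  have hsphere : ∀ x, ‖x‖ = 1 → a - ‖T‖ * ε ≤ ‖T x‖ := fun x hx => by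
    obtain ⟨c, hc, hxc⟩ := exists_norm_sub_le_of_isCover hs (mem_sphere_zero_iff_norm.2 hx)
    have htri : ‖T c‖ ≤ ‖T x‖ + ‖T (x - c)‖ := by
      rw [map_sub]
      exact norm_le_norm_add_norm_sub _ _
    linarith [hT c hc, T.le_opNorm_of_le hxc]
  rcases eq_or_ne x 0 with rfl | hx
  · simp
  have hx' : 0 < ‖x‖ := norm_pos_iff.2 hx
  have hscaled := hsphere (‖x‖⁻¹ • x) (norm_smul_inv_norm hx)
  rwa [map_smul, norm_smul, norm_inv, norm_norm, ← div_eq_inv_mul, le_div_iff₀ hx'] at hscaled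

end Nets

/-! ### Random operators -/

section CombinationCLM

variable {ι F : Type*} [Fintype ι] [NormedAddCommGroup F] [NormedSpace ℝ F]

/-- The operator `u ↦ ∑ i, u i • x i`. When the `x i` are the rows of a matrix, this is the
transpose of that matrix. -/
noncomputable def combinationCLM (x : ι → F) : EuclideanSpace ℝ ι →L[ℝ] F :=
  LinearMap.toContinuousLinearMap
    (Fintype.linearCombination ℝ x ∘ₗ (WithLp.linearEquiv 2 ℝ (ι → ℝ)).toLinearMap)

theorem combinationCLM_apply (x : ι → F) (u : EuclideanSpace ℝ ι) :
    combinationCLM x u = ∑ i, u i • x i :=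
  rfl

theorem combinationCLM_add (x x' : ι → F) :
    combinationCLM (x + x') = combinationCLM x + combinationCLM x' := by
  ext u
  simp only [combinationCLM_apply, add_apply, Pi.add_apply, smul_add, Finset.sum_add_distrib]

theorem comp_combinationCLM {G : Type*} [NormedAddCommGroup G] [NormedSpace ℝ G] (S : F →L[ℝ] G)
    (x : ι → F) : S ∘L combinationCLM x = combinationCLM fun i => S (x i) := by
  ext u
  simp only [ContinuousLinearMap.comp_apply, combinationCLM_apply, map_sum, map_smul]

theorem continuous_combinationCLM : Continuous (combinationCLM : (ι → F) → _) := by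
  refine continuous_clm_apply.2 fun u => ?_
  simp only [combinationCLM_apply]
  fun_prop

theorem combinationCLM_sum_smul {κ : Type*} [Fintype κ] (r : κ → F) (x : ι × κ → ℝ)
    (u : EuclideanSpace ℝ ι) :
    combinationCLM (fun i => ∑ j, x (i, j) • r j) u = ∑ q, x q • u q.1 • r q.2 := by
  simp only [combinationCLM_apply, Fintype.sum_prod_type, Finset.smul_sum, smul_comm (u _)]

theorem sum_norm_smul_sq_eq {κ : Type*} [Fintype κ] (r : κ → F) (u : EuclideanSpace ℝ ι) :
    ∑ q : ι × κ, ‖u q.1 • r q.2‖ ^ 2 = ‖u‖ ^ 2 * ∑ j, ‖r j‖ ^ 2 := by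
  simp only [norm_smul, mul_pow, Fintype.sum_prod_type, EuclideanSpace.norm_sq_eq,
    Finset.sum_mul_sum]

theorem norm_sum_smul_smul_sq_le {κ : Type*} [Fintype κ] {g : ℝ} (hg : 0 ≤ g) {r : κ → F}
    (hr : ∀ x : κ → ℝ, ‖∑ j, x j • r j‖ ^ 2 ≤ g * ∑ j, x j ^ 2) (u : EuclideanSpace ℝ ι)
    (x : ι × κ → ℝ) : ‖∑ q, x q • u q.1 • r q.2‖ ^ 2 ≤ ‖u‖ ^ 2 * g * ∑ q, x q ^ 2 := by
  calc ‖∑ q, x q • u q.1 • r q.2‖ ^ 2 = ‖∑ j, (∑ i, u i * x (i, j)) • r j‖ ^ 2 := by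
        simp only [Fintype.sum_prod_type_right, Finset.sum_smul, smul_smul, mul_comm (x _)]
    _ ≤ g * ∑ j, (∑ i, u i * x (i, j)) ^ 2 := hr _
    _ ≤ g * ∑ j, (∑ i, u i ^ 2) * ∑ i, x (i, j) ^ 2 := by
        gcongr
        exact Finset.sum_mul_sq_le_sq_mul_sq _ _ _
    _ = ‖u‖ ^ 2 * g * ∑ q, x q ^ 2 := by
        rw [← Finset.mul_sum, Fintype.sum_prod_type_right, EuclideanSpace.real_norm_sq_eq]
        ring

end CombinationCLM

theorem sum_norm_starProjection_sq_le {κ F : Type*} [Fintype κ] [NormedAddCommGroup F]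
    [InnerProductSpace ℝ F] {g : ℝ} (hg : 0 ≤ g) {r : κ → F}
    (hr : ∀ x : κ → ℝ, ‖∑ j, x j • r j‖ ^ 2 ≤ g * ∑ j, x j ^ 2) (W : Submodule ℝ F)
    [FiniteDimensional ℝ W] :
    ∑ j, ‖W.starProjection (r j)‖ ^ 2 ≤ Module.finrank ℝ W * g := by
  set b := stdOrthonormalBasis ℝ W
  have hparseval (x : F) : ‖W.starProjection x‖ ^ 2 = ∑ k, inner ℝ (b k : F) x ^ 2 := by
    have hcoe : ‖W.starProjection x‖ = ‖W.orthogonalProjectionOnto x‖ := rfl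
    rw [hcoe, ← b.sum_sq_norm_inner_right]
    simp only [Real.norm_eq_abs, sq_abs, W.inner_orthogonalProjectionOnto_eq_of_mem_left]
  have hb (k) : ‖(b k : F)‖ = 1 := b.orthonormal.1 k
  calc ∑ j, ‖W.starProjection (r j)‖ ^ 2 = ∑ k, ∑ j, inner ℝ (b k : F) (r j) ^ 2 := by
        simp only [hparseval]
        exact Finset.sum_comm
    _ ≤ ∑ k, g * ‖(b k : F)‖ ^ 2 := Finset.sum_le_sum fun k _ => sum_inner_sq_le hg hr _
    _ = Module.finrank ℝ W * g := by simp [hb]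

section WellSpread

variable {E F : Type*} [NormedAddCommGroup E] [NormedSpace ℝ E] [NormedAddCommGroup F]
  [InnerProductSpace ℝ F]

/-- `T` stretches no vector by more than `b`, and the image of every vector keeps a component of
relative size at least `a` orthogonal to `W`. -/
def IsWellSpread (W : Submodule ℝ F) [W.HasOrthogonalProjection] (a b : ℝ) (T : E →L[ℝ] F) :
    Prop :=
  ‖T‖ ≤ b ∧ ∀ u, a * ‖u‖ ≤ ‖Wᗮ.starProjection (T u)‖

theorem isClosed_setOf_isWellSpread (W : Submodule ℝ F) [W.HasOrthogonalProjection] (a b : ℝ) :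
    IsClosed {T : E →L[ℝ] F | IsWellSpread W a b T} := by
  simp only [IsWellSpread, Set.ofPred_and, Set.ofPred_forall]
  exact (isClosed_le (by fun_prop) (by fun_prop)).inter
    (isClosed_iInter fun u => isClosed_le (by fun_prop) (by fun_prop))

theorem isWellSpread_of_isCover {W : Submodule ℝ F} [W.HasOrthogonalProjection] {a b : ℝ}
    {ε : ℝ≥0} (hε : ε ≤ 1 / 2) (hb : 0 ≤ b) {s : Set E}
    (hs : Metric.IsCover ε (Metric.sphere 0 1) s) {T : E →L[ℝ] F} (hupper : ∀ c ∈ s, ‖T c‖ ≤ b)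
    (hlower : ∀ c ∈ s, a ≤ ‖Wᗮ.starProjection (T c)‖) :
    IsWellSpread W (a - 2 * b * ε) (2 * b) T := by
  have hT : ‖T‖ ≤ 2 * b := norm_le_of_isCover_sphere hε hb hs T hupper
  have hWT : ‖Wᗮ.starProjection ∘L T‖ ≤ 2 * b :=
    (Wᗮ.starProjection.opNorm_comp_le T).trans
      ((mul_le_of_le_one_left (norm_nonneg T) Wᗮ.starProjection_norm_le).trans hT)
  refine ⟨hT, fun u => ?_⟩
  calc (a - 2 * b * ε) * ‖u‖ ≤ (a - ‖Wᗮ.starProjection ∘L T‖ * ε) * ‖u‖ := by gcongr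
    _ ≤ ‖Wᗮ.starProjection (T u)‖ :=
      le_norm_of_isCover_sphere hs (Wᗮ.starProjection ∘L T) hlower u

theorem measure_not_isWellSpread_le_of_forall_norm_eq_one [FiniteDimensional ℝ E] {Ω : Type*}
    [MeasurableSpace Ω] {P : Measure Ω} {W : Submodule ℝ F} [W.HasOrthogonalProjection]
    {T : Ω → E →L[ℝ] F} {a b q : ℝ} {ε : ℝ≥0} (hε0 : 0 < ε) (hε : ε ≤ 1 / 2) (hb : 0 ≤ b)
    (hq : 0 ≤ q) (hupper : ∀ u, ‖u‖ = 1 → P {ω | b ≤ ‖T ω u‖} ≤ ENNReal.ofReal q)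
    (hlower : ∀ u, ‖u‖ = 1 → P {ω | ‖Wᗮ.starProjection (T ω u)‖ ≤ a} ≤ ENNReal.ofReal q) :
    P {ω | ¬ IsWellSpread W (a - 2 * b * ε) (2 * b) (T ω)}
      ≤ ENNReal.ofReal (2 * ((4 / ε) ^ Module.finrank ℝ E * q)) := by
  obtain ⟨s, hcard, hsphere, hcover⟩ := exists_finset_isCover (E := E) hε0
    (hε.trans one_half_lt_one.le) Metric.sphere_subset_closedBall
  have hunit {c : E} (hc : c ∈ s) : ‖c‖ = 1 := by simpa using hsphere hc
  have hsubset : {ω | ¬ IsWellSpread W (a - 2 * b * ε) (2 * b) (T ω)} ⊆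
      ⋃ c ∈ s, {ω | b ≤ ‖T ω c‖} ∪ {ω | ‖Wᗮ.starProjection (T ω c)‖ ≤ a} := by
    intro ω hω
    by_contra! hnot
    simp only [Set.mem_iUnion, Set.mem_union, Set.mem_ofPred_eq, not_exists, not_or,
      not_le] at hnot
    exact hω (isWellSpread_of_isCover hε hb hcover (fun c hc => (hnot c hc).1.le)
      fun c hc => (hnot c hc).2.le)
  calc P {ω | ¬ IsWellSpread W (a - 2 * b * ε) (2 * b) (T ω)}
      ≤ ∑ c ∈ s, P ({ω | b ≤ ‖T ω c‖} ∪ {ω | ‖Wᗮ.starProjection (T ω c)‖ ≤ a}) :=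
        (measure_mono hsubset).trans (measure_biUnion_finset_le _ _)
    _ ≤ ∑ _c ∈ s, (ENNReal.ofReal q + ENNReal.ofReal q) :=
        Finset.sum_le_sum fun c hc => (measure_union_le _ _).trans
          (add_le_add (hupper c (hunit hc)) (hlower c (hunit hc)))
    _ = ENNReal.ofReal (2 * (s.card * q)) := by
        rw [← ENNReal.ofReal_add hq hq, Finset.sum_const, nsmul_eq_mul, ← ENNReal.ofReal_natCast,
          ← ENNReal.ofReal_mul (by positivity)]
        ring_nf
    _ ≤ ENNReal.ofReal (2 * ((4 / ε) ^ Module.finrank ℝ E * q)) := by gcongr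

end WellSpread

section NoiseOperator

variable {Ω ι κ F : Type*} [MeasurableSpace Ω] {P : Measure Ω} [Fintype ι] [Fintype κ]
  [NormedAddCommGroup F] [InnerProductSpace ℝ F] {ξ : ι × κ → Ω → ℝ} {m g : ℝ} {r : κ → F}

theorem measure_le_norm_combinationCLM [IsProbabilityMeasure P] (hξ : iIndepFun ξ P)
    (hmeas : ∀ q, AEMeasurable (ξ q) P) (hsub : ∀ q, IsStdSubGaussian (P.map (ξ q)) m)
    (hm : 1 ≤ m) (hg : 0 < g) (hr : ∀ x : κ → ℝ, ‖∑ j, x j • r j‖ ^ 2 ≤ g * ∑ j, x j ^ 2)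
    {u : EuclideanSpace ℝ ι} (hu : ‖u‖ = 1) :
    P {ω | 2 * m * √(∑ j, ‖r j‖ ^ 2) ≤ ‖combinationCLM (fun i => ∑ j, ξ (i, j) ω • r j) u‖}
      ≤ ENNReal.ofReal (Real.exp (-((∑ j, ‖r j‖ ^ 2) / (16 * m ^ 4 * g)))) := by
  have hτ : 0 ≤ ∑ j, ‖r j‖ ^ 2 := by positivity
  have htail := measure_le_norm_sum_sq hξ hmeas hsub hm hg
    (v := fun q : ι × κ => u q.1 • r q.2) fun x => by
      simpa only [hu, one_pow, one_mul] using norm_sum_smul_smul_sq_le hg.le hr u x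
  rw [sum_norm_smul_sq_eq, hu, one_pow, one_mul] at htail
  refine (measure_mono fun ω hω => ?_).trans htail
  rw [Set.mem_ofPred_eq, combinationCLM_sum_smul r (fun q => ξ q ω)] at hω
  calc (3 * m ^ 2 + 1) * ∑ j, ‖r j‖ ^ 2 ≤ (2 * m) ^ 2 * ∑ j, ‖r j‖ ^ 2 := by
        gcongr
        nlinarith
    _ = (2 * m * √(∑ j, ‖r j‖ ^ 2)) ^ 2 := by rw [mul_pow _ √_, Real.sq_sqrt hτ]
    _ ≤ _ := by gcongr

theorem le_sum_norm_starProjection_orthogonal_sq (hg : 0 ≤ g)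
    (hr : ∀ x : κ → ℝ, ‖∑ j, x j • r j‖ ^ 2 ≤ g * ∑ j, x j ^ 2) (W : Submodule ℝ F)
    [FiniteDimensional ℝ W] :
    ∑ j, ‖r j‖ ^ 2 - Module.finrank ℝ W * g ≤ ∑ j, ‖Wᗮ.starProjection (r j)‖ ^ 2 := by
  have hpythagoras : ∑ j, ‖r j‖ ^ 2
      = ∑ j, ‖W.starProjection (r j)‖ ^ 2 + ∑ j, ‖Wᗮ.starProjection (r j)‖ ^ 2 := by
    rw [← Finset.sum_add_distrib]
    exact Finset.sum_congr rfl fun j _ => W.norm_sq_eq_add_norm_sq_starProjection (r j)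
  linarith [sum_norm_starProjection_sq_le hg hr W]

theorem measure_norm_starProjection_combinationCLM_le [IsProbabilityMeasure P]
    (hξ : iIndepFun ξ P) (hmeas : ∀ q, AEMeasurable (ξ q) P)
    (hsub : ∀ q, IsStdSubGaussian (P.map (ξ q)) m) (hm : 1 ≤ m) (hg : 0 < g)
    (hr : ∀ x : κ → ℝ, ‖∑ j, x j • r j‖ ^ 2 ≤ g * ∑ j, x j ^ 2) {W : Submodule ℝ F}
    [FiniteDimensional ℝ W] (hW : 2 * (Module.finrank ℝ W * g) ≤ ∑ j, ‖r j‖ ^ 2)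
    {u : EuclideanSpace ℝ ι} (hu : ‖u‖ = 1) :
    P {ω | ‖Wᗮ.starProjection (combinationCLM (fun i => ∑ j, ξ (i, j) ω • r j) u)‖
        ≤ √(∑ j, ‖r j‖ ^ 2) / 4}
      ≤ ENNReal.ofReal (Real.exp (-((∑ j, ‖r j‖ ^ 2) / (256 * m ^ 4 * g)))) := by
  set τ := ∑ j, ‖r j‖ ^ 2
  have hτ : 0 ≤ τ := by positivity
  set r' : κ → F := fun j => Wᗮ.starProjection (r j)
  have hτ' : τ / 2 ≤ ∑ j, ‖r' j‖ ^ 2 := by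
    linarith [le_sum_norm_starProjection_orthogonal_sq hg.le hr W]
  have hr' (x : κ → ℝ) : ‖∑ j, x j • r' j‖ ^ 2 ≤ g * ∑ j, x j ^ 2 := by
    refine le_trans ?_ (hr x)
    simp only [r', ← map_smul, ← map_sum]
    gcongr
    exact Wᗮ.norm_starProjection_apply_le _
  have htail := measure_norm_sum_sq_le hξ hmeas hsub hm hg
    (v := fun q : ι × κ => u q.1 • r' q.2) fun x => by
      simpa only [hu, one_pow, one_mul] using norm_sum_smul_smul_sq_le hg.le hr' u x
  rw [sum_norm_smul_sq_eq, hu, one_pow, one_mul] at htail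
  refine (measure_mono fun ω hω => ?_).trans (htail.trans ?_)
  · rw [Set.mem_ofPred_eq, ← ContinuousLinearMap.comp_apply, comp_combinationCLM] at hω
    simp only [map_sum, map_smul] at hω
    rw [combinationCLM_sum_smul r' (fun q => ξ q ω)] at hω
    calc ‖∑ q, ξ q ω • u q.1 • r' q.2‖ ^ 2 ≤ (√τ / 4) ^ 2 := by gcongr
      _ = τ / 16 := by rw [div_pow, Real.sq_sqrt hτ]; norm_num
      _ ≤ (∑ j, ‖r' j‖ ^ 2) / 8 := by linarith
  · have hrate : τ / (256 * m ^ 4 * g) ≤ (∑ j, ‖r' j‖ ^ 2) / (128 * m ^ 4 * g) :=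
      calc τ / (256 * m ^ 4 * g) = τ / 2 / (128 * m ^ 4 * g) := by rw [div_div]; ring_nf
        _ ≤ (∑ j, ‖r' j‖ ^ 2) / (128 * m ^ 4 * g) := by gcongr
    exact ENNReal.ofReal_le_ofReal (Real.exp_le_exp.2 (neg_le_neg hrate))

theorem pow_mul_exp_neg_le_exp_neg {a t : ℝ} (ha : 0 < a) {n : ℕ} (h : (Real.log a + 1) * n ≤ t) :
    a ^ n * Real.exp (-t) ≤ Real.exp (-n) := by
  rw [← Real.rpow_natCast, Real.rpow_def_of_pos ha, ← Real.exp_add, Real.exp_le_exp]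
  linarith

theorem measure_not_isWellSpread_le [IsProbabilityMeasure P] (hξ : iIndepFun ξ P)
    (hmeas : ∀ q, AEMeasurable (ξ q) P) (hsub : ∀ q, IsStdSubGaussian (P.map (ξ q)) m)
    (hm : 1 ≤ m) (hg : 0 < g) (hr : ∀ x : κ → ℝ, ‖∑ j, x j • r j‖ ^ 2 ≤ g * ∑ j, x j ^ 2)
    {W : Submodule ℝ F} [FiniteDimensional ℝ W]
    (hW : 2 * (Module.finrank ℝ W * g) ≤ ∑ j, ‖r j‖ ^ 2)
    (hι : 256 * m ^ 4 * (Real.log (128 * m) + 1) * Fintype.card ι ≤ (∑ j, ‖r j‖ ^ 2) / g) :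
    P {ω | ¬ IsWellSpread W (√(∑ j, ‖r j‖ ^ 2) / 8) (4 * m * √(∑ j, ‖r j‖ ^ 2))
        (combinationCLM fun i => ∑ j, ξ (i, j) ω • r j)}
      ≤ ENNReal.ofReal (2 * Real.exp (-(Fintype.card ι : ℝ))) := by
  set τ := ∑ j, ‖r j‖ ^ 2
  set q := Real.exp (-(τ / (256 * m ^ 4 * g)))
  have hm0 : 0 < m := one_pos.trans_le hm
  obtain ⟨ε, hε⟩ : ∃ ε : ℝ≥0, (ε : ℝ) = 1 / (32 * m) := ⟨⟨1 / (32 * m), by positivity⟩, rfl⟩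
  have hε0 : 0 < ε := by rw [← NNReal.coe_pos, hε]; positivity
  have hε' : ε ≤ 1 / 2 := by
    rw [← NNReal.coe_le_coe, hε]
    push_cast
    gcongr
    linarith
  have hq : Real.exp (-(τ / (16 * m ^ 4 * g))) ≤ q := by
    unfold q
    gcongr
    norm_num
  have hnet := measure_not_isWellSpread_le_of_forall_norm_eq_one (W := W) hε0 hε'
    (by positivity) (Real.exp_pos _).le
    (fun u hu => (measure_le_norm_combinationCLM hξ hmeas hsub hm hg hr hu).trans
      (ENNReal.ofReal_le_ofReal hq))
    (fun u hu => measure_norm_starProjection_combinationCLM_le hξ hmeas hsub hm hg hr hW hu)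
  have hlower : √τ / 4 - 2 * (2 * m * √τ) * ε = √τ / 8 := by
    rw [hε]
    field_simp
    ring
  have hbase : 4 / (ε : ℝ) = 128 * m := by
    rw [hε]
    field_simp
    norm_num
  have hupper : 2 * (2 * m * √τ) = 4 * m * √τ := by ring
  rw [hlower, hupper, hbase, finrank_euclideanSpace] at hnet
  refine hnet.trans ?_
  gcongr
  refine pow_mul_exp_neg_le_exp_neg (by positivity) ?_
  rw [le_div_iff₀ hg] at hι
  rw [le_div_iff₀ (by positivity)]
  linarith

end NoiseOperator

/-! ### Least squares with an operator that is bounded below -/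

theorem exists_adjoint_eq_and_norm_le {E F : Type*} [NormedAddCommGroup E]
    [InnerProductSpace ℝ E] [FiniteDimensional ℝ E] [CompleteSpace E] [NormedAddCommGroup F]
    [InnerProductSpace ℝ F] [CompleteSpace F] {T : E →L[ℝ] F} {s : ℝ} (hs : 0 < s)
    (hT : ∀ u, s * ‖u‖ ≤ ‖T u‖) (v : E) :
    ∃ x, ContinuousLinearMap.adjoint T x = v ∧ ‖x‖ ≤ ‖v‖ / s := by
  have hinner (u w : E) :
      inner ℝ (ContinuousLinearMap.adjoint T (T u)) w = inner ℝ (T u) (T w) :=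
    T.adjoint_inner_left w (T u)
  have hinj : Function.Injective (ContinuousLinearMap.adjoint T ∘L T).toLinearMap := by
    refine (injective_iff_map_eq_zero _).2 fun u hu => ?_
    have hTu : T u = 0 := by
      rw [← inner_self_eq_zero (𝕜 := ℝ), ← hinner]
      exact (congrArg (inner ℝ · u) hu).trans (inner_zero_left u)
    have hsu := hT u
    rw [hTu, norm_zero] at hsu
    exact norm_le_zero_iff.1 (nonpos_of_mul_nonpos_right hsu hs)
  obtain ⟨u, hu⟩ := LinearMap.injective_iff_surjective.1 hinj v
  refine ⟨T u, hu, ?_⟩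
  have hle : ‖T u‖ * (s * ‖u‖) ≤ ‖v‖ * ‖u‖ :=
    calc ‖T u‖ * (s * ‖u‖) ≤ ‖T u‖ * ‖T u‖ := by gcongr; exact hT u
      _ = inner ℝ v u := by rw [← real_inner_self_eq_norm_mul_norm, ← hinner, ← hu]; rfl
      _ ≤ ‖v‖ * ‖u‖ := real_inner_le_norm v u
  rcases eq_or_ne u 0 with rfl | hu0
  · rw [map_zero, norm_zero]
    positivity
  · rw [le_div_iff₀ hs]
    exact le_of_mul_le_mul_right (by linarith) (norm_pos_iff.2 hu0)

theorem toEuclideanLin_eq_adjoint_combinationCLM {ι κ : Type*} [Fintype ι] [Fintype κ]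
    [DecidableEq κ] (X : Matrix ι κ ℝ) (a : EuclideanSpace ℝ κ) :
    Matrix.toEuclideanLin X a
      = ContinuousLinearMap.adjoint (combinationCLM fun i => WithLp.toLp 2 (X i)) a := by
  refine ext_inner_right ℝ fun u => ?_
  rw [ContinuousLinearMap.adjoint_inner_left, combinationCLM_apply, inner_sum]
  simp only [inner_smul_right, PiLp.inner_apply]
  exact Finset.sum_congr rfl fun i _ => by
    simp [Matrix.mulVec, dotProduct]

theorem norm_minNormLeastSquares_le {n p : ℕ} {X : Matrix (Fin n) (Fin p) ℝ} {s : ℝ} (hs : 0 < s)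
    (hX : ∀ u, s * ‖u‖ ≤ ‖combinationCLM (fun i => WithLp.toLp 2 (X i)) u‖)
    (y : EuclideanSpace ℝ (Fin n)) (a : EuclideanSpace ℝ (Fin p)) :
    ‖minNormLeastSquares X y‖ ≤ ‖a‖ + ‖y - Matrix.toEuclideanLin X a‖ / s := by
  obtain ⟨x, hx, hxn⟩ := exists_adjoint_eq_and_norm_le hs hX (y - Matrix.toEuclideanLin X a)
  rw [← toEuclideanLin_eq_adjoint_combinationCLM] at hx
  have hls : IsLeastSquares X y (a + x) := fun u => by
    rw [map_add, hx, add_sub_cancel, sub_self, norm_zero]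
    exact norm_nonneg _
  calc ‖minNormLeastSquares X y‖ ≤ ‖a + x‖ :=
        (isMinNormLeastSquares_minNormLeastSquares X y).2 _ hls
    _ ≤ ‖a‖ + ‖x‖ := norm_add_le a x
    _ ≤ ‖a‖ + ‖y - Matrix.toEuclideanLin X a‖ / s := by gcongr

theorem IsWellSpread.le_norm_add {E F : Type*} [NormedAddCommGroup E] [NormedSpace ℝ E]
    [NormedAddCommGroup F] [InnerProductSpace ℝ F] {W : Submodule ℝ F} [W.HasOrthogonalProjection]
    {a b : ℝ} {T S : E →L[ℝ] F} (hT : IsWellSpread W a b T) (hS : ∀ u, S u ∈ W) (u : E) :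
    a * ‖u‖ ≤ ‖(S + T) u‖ :=
  calc a * ‖u‖ ≤ ‖Wᗮ.starProjection (T u)‖ := hT.2 u
    _ = ‖Wᗮ.starProjection ((S + T) u)‖ := by
      rw [add_apply, map_add, W.starProjection_orthogonal_apply_eq_zero (hS u), zero_add]
    _ ≤ ‖(S + T) u‖ := Wᗮ.norm_starProjection_apply_le _

/-- When the signal is `β = Aᵀ a`, the residual of `a` is `ε - 𝐄 a`: no factor survives. -/
theorem norm_minNormLeastSquares_factor_le {n p K : ℕ} (A : Matrix (Fin p) (Fin K) ℝ)
    (z : Fin n → Fin K → ℝ) {e : Fin n → Fin p → ℝ} (ε : EuclideanSpace ℝ (Fin n))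
    (a : EuclideanSpace ℝ (Fin p)) {s b : ℝ} (hs : 0 < s)
    (he : IsWellSpread (Matrix.toEuclideanLin A).range s b
      (combinationCLM fun i => WithLp.toLp 2 (e i))) :
    ‖minNormLeastSquares (Matrix.of fun i => A.mulVec (z i) + e i)
        (WithLp.toLp 2 fun i => z i ⬝ᵥ A.transpose.mulVec a + ε i)‖
      ≤ ‖a‖ + (b * ‖a‖ + ‖ε‖) / s := by
  set X : Matrix (Fin n) (Fin p) ℝ := Matrix.of fun i => A.mulVec (z i) + e i
  set y : EuclideanSpace ℝ (Fin n) := WithLp.toLp 2 fun i => z i ⬝ᵥ A.transpose.mulVec a + ε i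
  have hX (u) : s * ‖u‖ ≤ ‖combinationCLM (fun i => WithLp.toLp 2 (X i)) u‖ := by
    have hrows : (fun i => WithLp.toLp 2 (X i))
        = (fun i => Matrix.toEuclideanLin A (WithLp.toLp 2 (z i)))
          + fun i => WithLp.toLp 2 (e i) := rfl
    rw [hrows, combinationCLM_add]
    refine he.le_norm_add (fun u => ?_) u
    rw [combinationCLM_apply]
    exact Submodule.sum_smul_mem _ _ fun i _ => LinearMap.mem_range_self _ _
  have hresidual : y - Matrix.toEuclideanLin X a
      = ε - Matrix.toEuclideanLin (Matrix.of e) a := by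
    ext i
    change z i ⬝ᵥ A.transpose.mulVec a + ε i - (A.mulVec (z i) + e i) ⬝ᵥ a.ofLp
      = ε i - e i ⬝ᵥ a.ofLp
    rw [Matrix.dotProduct_mulVec, Matrix.vecMul_transpose, add_dotProduct]
    ring
  have hnoise : ‖Matrix.toEuclideanLin (Matrix.of e) a‖ ≤ b * ‖a‖ := by
    rw [toEuclideanLin_eq_adjoint_combinationCLM]
    refine (ContinuousLinearMap.le_opNorm _ a).trans ?_
    rw [LinearIsometryEquiv.norm_map]
    exact mul_le_mul_of_nonneg_right he.1 (norm_nonneg a)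
  calc ‖minNormLeastSquares X y‖ ≤ ‖a‖ + ‖y - Matrix.toEuclideanLin X a‖ / s :=
        norm_minNormLeastSquares_le hs hX y a
    _ ≤ ‖a‖ + (b * ‖a‖ + ‖ε‖) / s := by
        rw [hresidual]
        gcongr
        linarith [norm_sub_le ε (Matrix.toEuclideanLin (Matrix.of e) a)]

/-! ### The smallest positive eigenvalue and the coefficients of the signal -/

theorem antitone_pos_iff_lt_card {d : ℕ} {f : Fin d → ℝ} (hf : Antitone f) (i : Fin d) :
    0 < f i ↔ (i : ℕ) < Fintype.card {j // 0 < f j} := by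
  rw [Fintype.card_subtype]
  constructor
  · intro hi
    have hsubset : Finset.Iic i ⊆ Finset.univ.filter fun j => 0 < f j := fun j hj => by
      simpa using hi.trans_le (hf (Finset.mem_Iic.1 hj))
    simpa [Nat.succ_le_iff] using Finset.card_le_card hsubset
  · contrapose!
    intro hi
    have hsubset : (Finset.univ.filter fun j => 0 < f j) ⊆ Finset.Iio i := fun j hj => by
      rw [Finset.mem_Iio]
      by_contra! hij
      exact ((Finset.mem_filter.1 hj).2.trans_le (hf hij)).not_ge hi
    simpa using Finset.card_le_card hsubset

section OrderedEigenvalue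

variable {p : ℕ} {N : Matrix (Fin p) (Fin p) ℝ}

theorem eigenvalues₀_nonneg (hN : N.PosSemidef) (i) : 0 ≤ hN.1.eigenvalues₀ i := by
  simpa [Matrix.IsHermitian.eigenvalues] using hN.eigenvalues_nonneg
    (Fintype.equivOfCardEq (Fintype.card_fin (Fintype.card (Fin p))) i)

theorem eigenvalues₀_pos_iff_lt_rank (hN : N.PosSemidef) (i) :
    0 < hN.1.eigenvalues₀ i ↔ (i : ℕ) < N.rank := by
  rw [antitone_pos_iff_lt_card hN.1.eigenvalues₀_antitone, hN.1.rank_eq_card_non_zero_eigs]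
  refine iff_of_eq (congrArg _ (Fintype.card_congr (Equiv.subtypeEquiv
    (Fintype.equivOfCardEq (Fintype.card_fin (Fintype.card (Fin p)))) fun j => ?_)))
  simp [Matrix.IsHermitian.eigenvalues, (eigenvalues₀_nonneg hN j).lt_iff_ne']

theorem orderedEigenvalue_rank_eq (hN : N.PosSemidef) (hrank : 1 ≤ N.rank) :
    orderedEigenvalue N N.rank = hN.1.eigenvalues₀
      ⟨N.rank - 1, by have := N.rank_le_width; rw [Fintype.card_fin]; omega⟩ :=
  dif_pos ⟨hN.1, hrank, N.rank_le_width⟩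

theorem orderedEigenvalue_rank_pos (hN : N.PosSemidef) (hrank : 1 ≤ N.rank) :
    0 < orderedEigenvalue N N.rank := by
  rw [orderedEigenvalue_rank_eq hN hrank, eigenvalues₀_pos_iff_lt_rank hN]
  exact Nat.sub_one_lt_of_lt hrank

theorem orderedEigenvalue_rank_le (hN : N.PosSemidef) {i} (hi : hN.1.eigenvalues₀ i ≠ 0) :
    orderedEigenvalue N N.rank ≤ hN.1.eigenvalues₀ i := by
  have hlt := (eigenvalues₀_pos_iff_lt_rank hN i).1 ((eigenvalues₀_nonneg hN i).lt_of_ne' hi)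
  rw [orderedEigenvalue_rank_eq hN (by omega)]
  exact hN.1.eigenvalues₀_antitone (Fin.mk_le_mk.2 (by omega))

theorem orderedEigenvalue_rank_mul_norm_sq_le (hN : N.PosSemidef)
    {x : EuclideanSpace ℝ (Fin p)} (hx : x ∈ (Matrix.toEuclideanLin N).range) :
    orderedEigenvalue N N.rank * ‖x‖ ^ 2 ≤ inner ℝ x (Matrix.toEuclideanLin N x) := by
  obtain ⟨z, rfl⟩ := hx
  have hT := Matrix.isSymmetric_toEuclideanLin_iff.mpr hN.1
  set T := Matrix.toEuclideanLin N
  set v := hT.eigenvectorBasis finrank_euclideanSpace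
  have hTv (i) (x : EuclideanSpace ℝ (Fin p)) :
      inner ℝ (v i) (T x) = hN.1.eigenvalues₀ i * inner ℝ (v i) x := by
    have hdiagonal := hT.eigenvectorBasis_apply_self_apply finrank_euclideanSpace x i
    rwa [OrthonormalBasis.repr_apply_apply, OrthonormalBasis.repr_apply_apply] at hdiagonal
  rw [← real_inner_self_eq_norm_sq, ← v.sum_inner_mul_inner, ← v.sum_inner_mul_inner,
    Finset.mul_sum]
  refine Finset.sum_le_sum fun i _ => ?_
  rw [real_inner_comm, hTv i (T z), hTv i z]
  rcases eq_or_ne (hN.1.eigenvalues₀ i) 0 with hi | hi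
  · simp [hi]
  · nlinarith [orderedEigenvalue_rank_le hN hi, sq_nonneg (hN.1.eigenvalues₀ i * inner ℝ (v i) z)]

end OrderedEigenvalue

theorem mulVecLin_range_eq_top_of_rank_eq {m n : ℕ} {A : Matrix (Fin m) (Fin n) ℝ}
    (hA : A.rank = m) : A.mulVecLin.range = ⊤ :=
  Submodule.eq_top_of_finrank_eq (hA.trans (Module.finrank_fin_fun ℝ).symm)

section SignalVector

variable {p K : ℕ} {A : Matrix (Fin p) (Fin K) ℝ} {S : Matrix (Fin K) (Fin K) ℝ}

theorem mulVecLin_range_mul_mul_transpose (hA : A.rank = K) (hS : S.rank = K) :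
    (A * S * A.transpose).mulVecLin.range = A.mulVecLin.range := by
  have hS' := mulVecLin_range_eq_top_of_rank_eq hS
  have hA' := mulVecLin_range_eq_top_of_rank_eq (A.rank_transpose.trans hA)
  rw [Matrix.mulVecLin_mul, LinearMap.range_comp_of_range_eq_top _ hA', Matrix.mulVecLin_mul,
    LinearMap.range_comp_of_range_eq_top _ hS']

/-- The preimage `a` of `β` is taken in the range of `A`, which is also the range of
`A * S * Aᵀ`; there the eigenvalue bounds the quadratic form, whose value at `a` is `βᵀ S β`. -/
theorem exists_transpose_mulVec_eq_and_norm_sq_le (hK : 1 ≤ K) (hS : S.PosSemidef)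
    (hA : A.rank = K) (hS' : S.rank = K) (β : Fin K → ℝ) :
    ∃ a : EuclideanSpace ℝ (Fin p), A.transpose.mulVec a = β ∧
      ‖a‖ ^ 2 ≤ (β ⬝ᵥ S.mulVec β) / orderedEigenvalue (A * S * A.transpose) K := by
  have hN : (A * S * A.transpose).PosSemidef := by
    simpa only [Matrix.conjTranspose_eq_transpose_of_trivial] using hS.mul_mul_conjTranspose_same A
  have hrange := mulVecLin_range_mul_mul_transpose hA hS'
  have hrank : (A * S * A.transpose).rank = K := by rw [Matrix.rank, hrange]; exact hA
  have hgram := mulVecLin_range_eq_top_of_rank_eq (A.rank_transpose_mul_self.trans hA)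
  obtain ⟨w, hw⟩ := LinearMap.range_eq_top.1 hgram β
  have hAw : A.transpose.mulVec (A.mulVec w) = β := by
    rw [Matrix.mulVec_mulVec]
    exact hw
  obtain ⟨z, hz⟩ : A.mulVec w ∈ (A * S * A.transpose).mulVecLin.range := hrange ▸ ⟨w, rfl⟩
  have hle := orderedEigenvalue_rank_mul_norm_sq_le hN
    (x := WithLp.toLp 2 (A.mulVec w)) ⟨WithLp.toLp 2 z, congrArg (WithLp.toLp 2) hz⟩
  have hpos := orderedEigenvalue_rank_pos hN (hK.trans_eq hrank.symm)
  rw [hrank] at hle hpos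
  refine ⟨WithLp.toLp 2 (A.mulVec w), hAw, (le_div_iff₀' hpos).2 (hle.trans_eq ?_)⟩
  rw [EuclideanSpace.inner_eq_star_dotProduct, star_trivial, dotProduct_comm]
  change A.mulVec w ⬝ᵥ (A * S * A.transpose).mulVec (A.mulVec w) = β ⬝ᵥ S.mulVec β
  rw [← Matrix.mulVec_mulVec, hAw, ← Matrix.mulVec_mulVec, Matrix.dotProduct_mulVec,
    ← Matrix.mulVec_transpose, hAw]

end SignalVector

theorem posSemidef_covarianceMatrix {Ω : Type*} [MeasurableSpace Ω] {P : Measure Ω}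
    [IsFiniteMeasure P] {d : ℕ} {V : Ω → Fin d → ℝ} (hV : ∀ j, MemLp (fun ω => V ω j) 2 P) :
    (covarianceMatrix P V).PosSemidef := by
  refine Matrix.PosSemidef.of_dotProduct_mulVec_nonneg ?_ fun x => ?_
  · ext j k
    exact covariance_comm _ _
  · have hx (j) : MemLp (fun ω => x j * V ω j) 2 P := (hV j).const_mul (x j)
    have hvar : star x ⬝ᵥ (covarianceMatrix P V).mulVec x = Var[fun ω => ∑ j, x j * V ω j; P] := by
      rw [← covariance_self (memLp_finsetSum _ fun j _ => hx j).aestronglyMeasurable.aemeasurable,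
        covariance_fun_sum_fun_sum hx hx]
      simp only [dotProduct, Matrix.mulVec, covarianceMatrix, Matrix.of_apply, star_trivial,
        Finset.mul_sum, covariance_const_mul_left, covariance_const_mul_right]
      exact Finset.sum_congr rfl fun i _ => Finset.sum_congr rfl fun j _ => by ring
    rw [hvar]
    exact variance_nonneg _ _

/-! ### Sub-Gaussian norms and square roots of matrices -/

section PsiTwo

variable {Ω : Type*} [MeasurableSpace Ω] {P : Measure Ω} {U : Ω → ℝ} {M : ℝ≥0}

theorem lintegral_exp_sq_le_of_psiTwoNorm_le (h : psiTwoNorm P U ≤ M) :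
    ∫⁻ ω, ENNReal.ofReal (Real.exp (U ω ^ 2 / ((M : ℝ) + 1) ^ 2)) ∂P ≤ 2 := by
  have hlt : psiTwoNorm P U < ((M + 1 : ℝ≥0) : ℝ≥0∞) :=
    h.trans_lt (ENNReal.coe_lt_coe.2 (lt_add_one M))
  simp only [psiTwoNorm, iInf_lt_iff] at hlt
  obtain ⟨t, ht, hle, htM⟩ := hlt
  refine (lintegral_mono fun ω => ENNReal.ofReal_le_ofReal (Real.exp_le_exp.2 ?_)).trans hle
  have : (0 : ℝ) < t := ht
  have htM' : (t : ℝ) ≤ M + 1 := by exact_mod_cast (ENNReal.coe_lt_coe.1 htM).le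
  gcongr

theorem isStdSubGaussian_of_psiTwoNorm_le (hU : Measurable U) (h : psiTwoNorm P U ≤ M)
    (hmean : ∫ ω, U ω ∂P = 0) (hvar : Var[U; P] = 1) : IsStdSubGaussian (P.map U) (M + 1) := by
  have hlintegral := lintegral_exp_sq_le_of_psiTwoNorm_le h
  have hcont : Continuous fun x : ℝ => Real.exp (x ^ 2 / ((M : ℝ) + 1) ^ 2) := by fun_prop
  have hmeas : Measurable fun ω => Real.exp (U ω ^ 2 / ((M : ℝ) + 1) ^ 2) :=
    hcont.measurable.comp hU
  have hnonneg : 0 ≤ᵐ[P] fun ω => Real.exp (U ω ^ 2 / ((M : ℝ) + 1) ^ 2) :=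
    ae_of_all _ fun ω => (Real.exp_pos _).le
  refine ⟨by simp, ?_, ?_, ?_, ?_⟩
  · rw [integrable_map_measure hcont.aestronglyMeasurable hU.aemeasurable]
    exact (lintegral_ofReal_ne_top_iff_integrable hmeas.aestronglyMeasurable hnonneg).1
      (ne_top_of_le_ne_top ENNReal.ofNat_ne_top hlintegral)
  · rw [integral_map hU.aemeasurable hcont.aestronglyMeasurable,
      integral_eq_lintegral_of_nonneg_ae hnonneg hmeas.aestronglyMeasurable]
    exact ENNReal.toReal_le_of_le_ofReal zero_le_two (by simpa using hlintegral)
  · rwa [integral_map hU.aemeasurable (by fun_prop)]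
  · rwa [integral_map hU.aemeasurable (by fun_prop),
      ← variance_of_integral_eq_zero hU.aemeasurable hmean]

theorem measure_sq_gt_le_of_psiTwoNorm_le (hU : Measurable U) (h : psiTwoNorm P U ≤ M)
    {n : ℝ} (hn : 0 < n) :
    P {ω | 2 * ((M : ℝ) + 1) ^ 2 * Real.log n < U ω ^ 2} ≤ ENNReal.ofReal (2 / n ^ 2) := by
  have hexp : Real.exp (Real.log 2 - 2 * Real.log n) = 2 / n ^ 2 := by
    rw [Real.exp_sub, Real.exp_log two_pos, two_mul, Real.exp_add, Real.exp_log hn, sq]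
  have hmarkov := measure_le_of_lintegral_exp_le (P := P)
    (f := fun ω => U ω ^ 2 / ((M : ℝ) + 1) ^ 2) (s := Real.log 2) (by fun_prop)
    (2 * Real.log n) (by
      rw [Real.exp_log two_pos, ENNReal.ofReal_ofNat]
      exact lintegral_exp_sq_le_of_psiTwoNorm_le h)
  rw [hexp] at hmarkov
  refine (measure_mono fun ω hω => ?_).trans hmarkov
  simp only [Set.mem_ofPred_eq] at hω ⊢
  rw [le_div_iff₀ (by positivity)]
  linarith

end PsiTwo

section Sqrt

variable {d : ℕ} {Q : Matrix (Fin d) (Fin d) ℝ}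

theorem toLp_mulVec_eq_sum_col (S : Matrix (Fin d) (Fin d) ℝ) (x : Fin d → ℝ) :
    WithLp.toLp 2 (S.mulVec x) = ∑ j, x j • WithLp.toLp 2 (S.col j) := by
  ext i
  simp [Matrix.mulVec, dotProduct, mul_comm]

theorem norm_sum_smul_col_sqrt_sq_le (hQ : Q.PosSemidef) (x : Fin d → ℝ) :
    ‖∑ j, x j • (WithLp.toLp 2 ((CFC.sqrt Q).col j) : EuclideanSpace ℝ (Fin d))‖ ^ 2
      ≤ matrixOpNorm Q * ∑ j, x j ^ 2 := by
  set T := Matrix.toEuclideanCLM (𝕜 := ℝ) (CFC.sqrt Q)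
  have hTT (z : EuclideanSpace ℝ (Fin d)) :
      T (T z) = Matrix.toEuclideanCLM (𝕜 := ℝ) Q z := by
    conv_rhs => rw [← CFC.sqrt_mul_sqrt_self Q hQ.nonneg, map_mul]
    rfl
  have hsymm := Matrix.isSymmetric_toEuclideanLin_iff.mpr
    (Matrix.nonneg_iff_posSemidef.1 (CFC.sqrt_nonneg Q)).1
  rw [← toLp_mulVec_eq_sum_col]
  set z : EuclideanSpace ℝ (Fin d) := WithLp.toLp 2 x
  calc ‖T z‖ ^ 2 = inner ℝ z (Matrix.toEuclideanCLM (𝕜 := ℝ) Q z) := by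
        rw [← hTT, ← real_inner_self_eq_norm_sq]
        exact hsymm z (T z)
    _ ≤ ‖z‖ * (matrixOpNorm Q * ‖z‖) :=
        (real_inner_le_norm _ _).trans (by gcongr; exact ContinuousLinearMap.le_opNorm _ _)
    _ = matrixOpNorm Q * ∑ j, x j ^ 2 := by
        rw [mul_left_comm, ← sq, EuclideanSpace.real_norm_sq_eq]

theorem sum_norm_col_sqrt_sq (hQ : Q.PosSemidef) :
    ∑ j, ‖(WithLp.toLp 2 ((CFC.sqrt Q).col j) : EuclideanSpace ℝ (Fin d))‖ ^ 2 = Q.trace := by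
  have hsymm : (CFC.sqrt Q).transpose = CFC.sqrt Q := by
    simpa only [Matrix.conjTranspose_eq_transpose_of_trivial] using
      (Matrix.nonneg_iff_posSemidef.1 (CFC.sqrt_nonneg Q)).1.eq
  conv_rhs => rw [← CFC.sqrt_mul_sqrt_self Q hQ.nonneg]
  refine Finset.sum_congr rfl fun j _ => ?_
  rw [EuclideanSpace.real_norm_sq_eq, Matrix.diag_apply, Matrix.mul_apply]
  refine Finset.sum_congr rfl fun i _ => ?_
  rw [sq, ← congrFun₂ hsymm j i]
  rfl

end Sqrt

/-! ### Samples from a product distribution -/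

section Sample

variable {Ω Ω₀ ι κ : Type*} [MeasurableSpace Ω] [MeasurableSpace Ω₀] {P : Measure Ω}
  {P₀ : Measure Ω₀} [IsProbabilityMeasure P₀] [Fintype ι]

theorem map_comp_eval_pi {α : Type*} [MeasurableSpace α] {f : Ω₀ → α} (hf : Measurable f) (i : ι) :
    (Measure.pi fun _ : ι => P₀).map (fun ω => f (ω i)) = P₀.map f := by
  have heval := measurePreserving_eval (fun _ : ι => P₀) i
  conv_rhs => rw [← heval.map_eq, Measure.map_map hf heval.measurable]
  rfl

theorem iIndepFun_coord_eval_pi [Finite κ] {V : Ω₀ → κ → ℝ} (hV : Measurable V)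
    (hind : iIndepFun (fun j ω => V ω j) P₀) :
    iIndepFun (fun (q : ι × κ) ω => V (ω q.1) q.2) (Measure.pi fun _ : ι => P₀) := by
  have := Fintype.ofFinite κ
  have hcoord (j) : Measurable fun ω => V ω j := (measurable_pi_apply j).comp hV
  have hmeas (i : ι) (j : κ) : Measurable fun ω : ι → Ω₀ => V (ω i) j :=
    (hcoord j).comp (measurable_pi_apply i)
  refine iIndepFun_uncurry' (X := fun i j (ω : ι → Ω₀) => V (ω i) j) hmeas
    (iIndepFun_pi (X := fun _ : ι => V) fun _ => hV.aemeasurable) fun i => ?_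
  rw [iIndepFun_iff_map_fun_eq_pi_map fun j => (hmeas i j).aemeasurable]
  rw [iIndepFun_iff_map_fun_eq_pi_map fun j => (hcoord j).aemeasurable] at hind
  simp only [map_comp_eval_pi (hcoord _)]
  exact (map_comp_eval_pi hV i).trans hind

theorem identDistrib_eval_pi {α : Type*} [MeasurableSpace α] {X : ι → Ω → α} {V : Ω₀ → α}
    (hX : iIndepFun X P) (hV : Measurable V) (hXV : ∀ i, IdentDistrib (X i) V P P₀) :
    IdentDistrib (fun ω i => X i ω) (fun ω i => V (ω i)) P (Measure.pi fun _ : ι => P₀) :=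
  .pi (fun i => (hXV i).trans ⟨hV.aemeasurable, (hV.comp (measurable_pi_apply i)).aemeasurable,
    (map_comp_eval_pi hV i).symm⟩) hX (iIndepFun_pi (X := fun _ : ι => V) fun _ => hV.aemeasurable)

theorem one_sub_add_le_measureReal [IsProbabilityMeasure P] {s t u : Set Ω}
    (h : ∀ ω, ω ∉ s → ω ∉ t → ω ∈ u) : 1 - (P.real s + P.real t) ≤ P.real u := by
  have hcover : Set.univ ⊆ u ∪ (s ∪ t) := fun ω _ => by
    have := h ω
    simp only [Set.mem_union]
    tauto
  have hone := measureReal_mono (μ := P) hcover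
  rw [probReal_univ] at hone
  linarith [measureReal_union_le (μ := P) u (s ∪ t), measureReal_union_le (μ := P) s t]

theorem tendsto_measureReal_lt_of_sq_le {Ω : ℕ → Type*} [∀ m, MeasurableSpace (Ω m)]
    {P : ∀ m, Measure (Ω m)} [∀ m, IsProbabilityMeasure (P m)] {f : ∀ m, Ω m → ℝ} {b q : ℕ → ℝ}
    (hb : Tendsto b atTop (𝓝 0)) (hq : Tendsto q atTop (𝓝 1))
    (h : ∀ m, q m ≤ (P m).real {ω | f m ω ^ 2 ≤ b m}) {δ : ℝ} (hδ : 0 < δ) :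
    Tendsto (fun m => (P m).real {ω | f m ω < δ}) atTop (𝓝 1) := by
  refine tendsto_of_tendsto_of_tendsto_of_le_of_le' hq tendsto_const_nhds ?_
    (Eventually.of_forall fun m => measureReal_le_one)
  filter_upwards [hb.eventually_lt_const (pow_pos hδ 2)] with m hm
  exact (h m).trans (measureReal_mono fun ω hω => lt_of_pow_lt_pow_left₀ 2 hδ.le (hω.trans_lt hm))

end Sample

section EffectiveRank

variable {d : ℕ} {Q : Matrix (Fin d) (Fin d) ℝ}

theorem matrixOpNorm_pos (hQ : Q ≠ 0) : 0 < matrixOpNorm Q :=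
  norm_pos_iff.2 ((map_ne_zero_iff _ Matrix.toEuclideanCLM.injective).2 hQ)

theorem effectiveRank_mul_matrixOpNorm (Q : Matrix (Fin d) (Fin d) ℝ) :
    effectiveRank Q * matrixOpNorm Q = Q.trace := by
  by_cases hQ : Q = 0
  · simp [hQ, matrixOpNorm]
  · rw [effectiveRank, if_neg hQ, div_mul_cancel₀ _ (matrixOpNorm_pos hQ).ne']

theorem matrixOpNorm_pos_of_one_lt_effectiveRank (hQ : 1 < effectiveRank Q) :
    0 < matrixOpNorm Q :=
  matrixOpNorm_pos fun h => by simp [effectiveRank, h] at hQ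

theorem trace_pos_of_one_lt_effectiveRank (hQ : 1 < effectiveRank Q) : 0 < Q.trace := by
  rw [← effectiveRank_mul_matrixOpNorm]
  exact mul_pos (one_pos.trans hQ) (matrixOpNorm_pos_of_one_lt_effectiveRank hQ)

end EffectiveRank

/-! ### Factor regression -/

/-- The constant `C` of the theorem, at which the net argument goes through. -/
noncomputable def dimensionConstant (M : ℝ≥0) : ℝ :=
  256 * ((M : ℝ) + 1) ^ 4 * (Real.log (128 * (M + 1)) + 1)

theorem two_le_dimensionConstant (M : ℝ≥0) : 2 ≤ dimensionConstant M := by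
  have hpow : 1 ≤ ((M : ℝ) + 1) ^ 4 := one_le_pow₀ (by simp)
  have hlog : 0 ≤ Real.log (128 * ((M : ℝ) + 1)) :=
    Real.log_nonneg (by linarith [M.coe_nonneg])
  rw [dimensionConstant]
  nlinarith [mul_nonneg (sub_nonneg.2 hpow) hlog]

namespace FactorRegression

variable {n p K : ℕ} (F : FactorRegression.{u, v} n p K) {M : ℝ≥0} {C : ℝ}

/-- `E = Σ_E^{1/2} Ẽ`, where `Ẽ` has independent, centred entries with unit variance and
sub-Gaussian norm at most `M`. -/
def SubGaussianE (M : ℝ≥0) : Prop :=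
  ∃ Et : F.Ω₀ → Fin p → ℝ, Measurable Et ∧
    (∀ᵐ ω ∂F.P₀, F.E ω = (CFC.sqrt F.covE).mulVec (Et ω)) ∧
    iIndepFun (fun j ω => Et ω j) F.P₀ ∧
    ∀ j, ∫ ω, Et ω j ∂F.P₀ = 0 ∧ Var[fun ω => Et ω j; F.P₀] = 1 ∧
      psiTwoNorm F.P₀ (fun ω => Et ω j) ≤ M

/-- `ε = σ_ε ε̃`, where `ε̃` has sub-Gaussian norm at most `M`. -/
def SubGaussianε (M : ℝ≥0) : Prop :=
  ∃ εt : F.Ω₀ → ℝ, Measurable εt ∧ (∀ᵐ ω ∂F.P₀, F.ε ω = Real.sqrt F.varε * εt ω) ∧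
    psiTwoNorm F.P₀ εt ≤ M

/-- The conditions of a regression driven by its noise: the noise is sub-Gaussian, of effective rank
dominating both the sample size and the number of factors, and `A` and `Σ_Z` have full rank. -/
structure NoiseConditions (M : ℝ≥0) (C : ℝ) : Prop where
  one_le_K : 1 ≤ K
  one_le_n : 1 ≤ n
  fullRank : F.FullRank
  subGaussianE : F.SubGaussianE M
  subGaussianε : F.SubGaussianε M
  effectiveRank_large_n : C * n < effectiveRank F.covE
  effectiveRank_large_K : C * K < effectiveRank F.covE

/-- The operator `u ↦ ∑ᵢ uᵢ Eᵢ`, the transpose of the matrix with rows `Eᵢ`. -/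
noncomputable def noise (ω : F.Ω) : EuclideanSpace ℝ (Fin n) →L[ℝ] EuclideanSpace ℝ (Fin p) :=
  combinationCLM fun i => WithLp.toLp 2 (F.Es i ω)

/-- The event that the noise is as large as `√(tr Σ_E)` in every direction, even after projecting
away the range of `A`, and of no larger order. -/
def WellSpreadNoise (m : ℝ) (ω : F.Ω) : Prop :=
  IsWellSpread (Matrix.toEuclideanLin F.A).range (√F.covE.trace / 8)
    (4 * m * √F.covE.trace) (F.noise ω)

/-- The right-hand side of the bound on `‖α̂‖²`, without the constant. -/
noncomputable def normBound : ℝ :=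
  F.signal / F.signalEigenvalue + F.varε * (n * Real.log n / F.covE.trace)

variable {F}

theorem Conditions.noiseConditions (hF : F.Conditions M C) (hC : 1 ≤ C) :
    F.NoiseConditions M C := by
  obtain ⟨hE, -, εt, hmeas, hε, -, hψ⟩ := hF.subGaussian
  have hK : (1 : ℝ) ≤ K := by exact_mod_cast hF.one_le_K
  have hKn : (K : ℝ) ≤ n := by nlinarith [hF.n_large]
  exact ⟨hF.one_le_K, by exact_mod_cast hK.trans hKn, hF.fullRank, hE, ⟨εt, hmeas, hε, hψ⟩,
    hF.effectiveRank_large, by nlinarith [hF.effectiveRank_large]⟩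

theorem NoiseConditions.one_lt_effectiveRank (hF : F.NoiseConditions M C) (hC : 1 ≤ C) :
    1 < effectiveRank F.covE :=
  (one_le_mul_of_one_le_of_one_le hC (by exact_mod_cast hF.one_le_n)).trans_lt
    hF.effectiveRank_large_n

variable (F)

theorem posSemidef_covE : F.covE.PosSemidef := posSemidef_covarianceMatrix F.memLp_E

theorem posSemidef_covZ : F.covZ.PosSemidef := posSemidef_covarianceMatrix F.memLp_Z

theorem varε_nonneg : 0 ≤ F.varε := variance_nonneg _ _

theorem identDistrib_Es (i : Fin n) : IdentDistrib (F.Es i) F.E F.P F.P₀ :=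
  (F.identDistrib_sample i).comp (u := fun q : (Fin K → ℝ) × (Fin p → ℝ) × ℝ => q.2.1)
    (by fun_prop)

theorem identDistrib_εs (i : Fin n) : IdentDistrib (F.εs i) F.ε F.P F.P₀ :=
  (F.identDistrib_sample i).comp (u := fun q : (Fin K → ℝ) × (Fin p → ℝ) × ℝ => q.2.2)
    (by fun_prop)

theorem iIndepFun_Es : iIndepFun F.Es F.P :=
  F.iIndep_sample.comp (fun _ q => q.2.1) fun _ => by fun_prop

theorem identDistrib_noise_sample {Et : F.Ω₀ → Fin p → ℝ} (hEt : Measurable Et)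
    (hE : ∀ᵐ ω ∂F.P₀, F.E ω = (CFC.sqrt F.covE).mulVec (Et ω)) :
    IdentDistrib (fun ω i => F.Es i ω)
      (fun (ω : Fin n → F.Ω₀) i => (CFC.sqrt F.covE).mulVec (Et (ω i)))
      F.P (Measure.pi fun _ => F.P₀) :=
  identDistrib_eval_pi F.iIndepFun_Es
    ((Continuous.matrix_mulVec continuous_const continuous_id).measurable.comp hEt)
    fun i => (F.identDistrib_Es i).trans (.of_ae_eq F.measurable_E.aemeasurable hE)

variable {F}

theorem SubGaussianE.measure_not_wellSpreadNoise_le (hE : F.SubGaussianE M)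
    (hpos : 0 < matrixOpNorm F.covE)
    (hA : 2 * (Module.finrank ℝ (Matrix.toEuclideanLin F.A).range * matrixOpNorm F.covE)
      ≤ F.covE.trace)
    (hn : dimensionConstant M * n ≤ F.covE.trace / matrixOpNorm F.covE) :
    F.P {ω | ¬F.WellSpreadNoise (M + 1) ω} ≤ ENNReal.ofReal (2 * Real.exp (-n)) := by
  obtain ⟨Et, hEt, hEEt, hind, hmoments⟩ := hE
  have hcoord (j) : Measurable fun ω => Et ω j := (measurable_pi_apply j).comp hEt
  set r : Fin p → EuclideanSpace ℝ (Fin p) := fun j => WithLp.toLp 2 ((CFC.sqrt F.covE).col j)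
  have htrace : ∑ j, ‖r j‖ ^ 2 = F.covE.trace := sum_norm_col_sqrt_sq F.posSemidef_covE
  have hset : MeasurableSet {x : Fin n → Fin p → ℝ | ¬IsWellSpread
      (Matrix.toEuclideanLin F.A).range (√F.covE.trace / 8) (4 * ((M : ℝ) + 1) * √F.covE.trace)
      (combinationCLM fun i => WithLp.toLp 2 (x i))} :=
    ((isClosed_setOf_isWellSpread _ _ _).preimage (continuous_combinationCLM.comp
      (by fun_prop : Continuous fun (x : Fin n → Fin p → ℝ) i =>
        (WithLp.toLp 2 (x i) : EuclideanSpace ℝ (Fin p))))).measurableSet.compl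
  have hbound := measure_not_isWellSpread_le (P := Measure.pi fun _ : Fin n => F.P₀)
    (m := (M : ℝ) + 1) (r := r) (W := (Matrix.toEuclideanLin F.A).range)
    (iIndepFun_coord_eval_pi hEt hind)
    (fun q => ((hcoord q.2).comp (measurable_pi_apply q.1)).aemeasurable)
    (fun q => by
      rw [map_comp_eval_pi (hcoord q.2) q.1]
      exact isStdSubGaussian_of_psiTwoNorm_le (hcoord q.2) (hmoments q.2).2.2 (hmoments q.2).1
        (hmoments q.2).2.1)
    (by simp) hpos (norm_sum_smul_col_sqrt_sq_le F.posSemidef_covE)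
    (by rwa [htrace]) (by rwa [htrace, Fintype.card_fin])
  rw [htrace, Fintype.card_fin] at hbound
  refine ((F.identDistrib_noise_sample hEt hEEt).measure_mem_eq hset).trans_le
    (le_of_eq_of_le ?_ hbound)
  simp only [r, ← toLp_mulVec_eq_sum_col]
  rfl

theorem NoiseConditions.measureReal_not_wellSpreadNoise_le
    (hF : F.NoiseConditions M (dimensionConstant M)) :
    F.P.real {ω | ¬F.WellSpreadNoise (M + 1) ω} ≤ 2 / n := by
  have hC := two_le_dimensionConstant M
  have hop := matrixOpNorm_pos_of_one_lt_effectiveRank (hF.one_lt_effectiveRank (by linarith))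
  have htrace := effectiveRank_mul_matrixOpNorm F.covE
  have hrange : (Module.finrank ℝ (Matrix.toEuclideanLin F.A).range : ℝ) ≤ K := by
    exact_mod_cast (LinearMap.finrank_range_le _).trans_eq finrank_euclideanSpace_fin
  have hA : 2 * (Module.finrank ℝ (Matrix.toEuclideanLin F.A).range * matrixOpNorm F.covE)
      ≤ F.covE.trace := by
    rw [← htrace, ← mul_assoc]
    gcongr
    nlinarith [hF.effectiveRank_large_K]
  have hn : dimensionConstant M * n ≤ F.covE.trace / matrixOpNorm F.covE := by
    rw [← htrace, mul_div_cancel_right₀ _ hop.ne']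
    exact hF.effectiveRank_large_n.le
  have hn0 : (0 : ℝ) < n := by exact_mod_cast hF.one_le_n
  refine ENNReal.toReal_le_of_le_ofReal (by positivity)
    ((hF.subGaussianE.measure_not_wellSpreadNoise_le hop hA hn).trans
      (ENNReal.ofReal_le_ofReal ?_))
  rw [Real.exp_neg, ← div_eq_mul_inv]
  gcongr
  linarith [Real.add_one_le_exp (n : ℝ)]

theorem SubGaussianε.measure_lt_εs_sq_le (hε : F.SubGaussianε M) (i : Fin n) :
    F.P {ω | 2 * ((M : ℝ) + 1) ^ 2 * Real.log n * F.varε < F.εs i ω ^ 2}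
      ≤ ENNReal.ofReal (2 / (n : ℝ) ^ 2) := by
  obtain ⟨εt, hεt, hεε, hψ⟩ := hε
  have hset : MeasurableSet {x : ℝ | 2 * ((M : ℝ) + 1) ^ 2 * Real.log n * F.varε < x ^ 2} :=
    measurableSet_lt measurable_const (by fun_prop)
  refine ((F.identDistrib_εs i).measure_mem_eq hset).trans_le ((measure_mono_ae ?_).trans
    (measure_sq_gt_le_of_psiTwoNorm_le hεt hψ (by exact_mod_cast i.pos)))
  filter_upwards [hεε] with ω hω hlt
  change 2 * ((M : ℝ) + 1) ^ 2 * Real.log n * F.varε < F.ε ω ^ 2 at hlt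
  rw [hω, mul_pow, Real.sq_sqrt F.varε_nonneg, mul_comm F.varε] at hlt
  exact lt_of_mul_lt_mul_right hlt F.varε_nonneg

theorem SubGaussianε.measureReal_exists_lt_εs_sq_le (hε : F.SubGaussianε M) :
    F.P.real {ω | ∃ i, 2 * ((M : ℝ) + 1) ^ 2 * Real.log n * F.varε < F.εs i ω ^ 2} ≤ 2 / n := by
  rw [Set.ofPred_exists]
  calc _ ≤ ∑ i, F.P.real {ω | 2 * ((M : ℝ) + 1) ^ 2 * Real.log n * F.varε < F.εs i ω ^ 2} :=
        measureReal_iUnion_fintype_le _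
    _ ≤ ∑ _i : Fin n, 2 / (n : ℝ) ^ 2 := Finset.sum_le_sum fun i _ =>
        ENNReal.toReal_le_of_le_ofReal (by positivity) (hε.measure_lt_εs_sq_le i)
    _ = 2 / n := by
        rw [Finset.sum_const, Finset.card_univ, Fintype.card_fin, nsmul_eq_mul]
        rcases eq_or_ne (n : ℝ) 0 with hn | hn
        · simp [hn]
        · field_simp

theorem FullRank.exists_signal_vector (hF : F.FullRank) (hK : 1 ≤ K) :
    ∃ a : EuclideanSpace ℝ (Fin p), F.A.transpose.mulVec a = F.β ∧
      ‖a‖ ^ 2 ≤ F.signal / F.signalEigenvalue :=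
  exists_transpose_mulVec_eq_and_norm_sq_le hK F.posSemidef_covZ hF.1 hF.2 F.β

theorem FullRank.signal_div_nonneg (hF : F.FullRank) (hK : 1 ≤ K) :
    0 ≤ F.signal / F.signalEigenvalue :=
  let ⟨_, _, ha⟩ := hF.exists_signal_vector hK
  (sq_nonneg _).trans ha

theorem WellSpreadNoise.norm_αHat_le {m : ℝ} {ω : F.Ω} (hω : F.WellSpreadNoise m ω) (hm : 1 ≤ m)
    (hτ : 0 < F.covE.trace) {a : EuclideanSpace ℝ (Fin p)}
    (ha : F.A.transpose.mulVec a = F.β) :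
    ‖F.αHat ω‖ ≤ 33 * m * ‖a‖
      + 8 * ‖(WithLp.toLp 2 fun i => F.εs i ω : EuclideanSpace ℝ (Fin n))‖ / √F.covE.trace := by
  set ε : EuclideanSpace ℝ (Fin n) := WithLp.toLp 2 fun i => F.εs i ω
  have : 0 < √F.covE.trace := Real.sqrt_pos.2 hτ
  have hle := norm_minNormLeastSquares_factor_le F.A (fun i => F.Zs i ω) ε a
    (by positivity : 0 < √F.covE.trace / 8) hω
  rw [ha] at hle
  calc ‖F.αHat ω‖ ≤ ‖a‖ + (4 * m * √F.covE.trace * ‖a‖ + ‖ε‖) / (√F.covE.trace / 8) := hle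
    _ = ‖a‖ + 32 * m * ‖a‖ + 8 * ‖ε‖ / √F.covE.trace := by field_simp; ring
    _ ≤ 33 * m * ‖a‖ + 8 * ‖ε‖ / √F.covE.trace := by
        linarith [le_mul_of_one_le_left (norm_nonneg a) hm]

theorem WellSpreadNoise.norm_αHat_sq_le {m w : ℝ} {ω : F.Ω} (hω : F.WellSpreadNoise m ω)
    (hm : 1 ≤ m) (hτ : 0 < F.covE.trace) (hK : 1 ≤ K) (hF : F.FullRank)
    (hε : ∀ i, F.εs i ω ^ 2 ≤ w) :
    ‖F.αHat ω‖ ^ 2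
      ≤ 2178 * m ^ 2 * (F.signal / F.signalEigenvalue) + 128 * (n * w / F.covE.trace) := by
  obtain ⟨a, ha, hnorm⟩ := hF.exists_signal_vector hK
  set ε : EuclideanSpace ℝ (Fin n) := WithLp.toLp 2 fun i => F.εs i ω
  have hεw : ‖ε‖ ^ 2 ≤ n * w := by
    rw [EuclideanSpace.real_norm_sq_eq]
    exact (Finset.sum_le_sum fun i _ => hε i).trans_eq (by simp)
  calc ‖F.αHat ω‖ ^ 2 ≤ (33 * m * ‖a‖ + 8 * ‖ε‖ / √F.covE.trace) ^ 2 := by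
        gcongr
        exact hω.norm_αHat_le hm hτ ha
    _ ≤ 2 * ((33 * m * ‖a‖) ^ 2 + (8 * ‖ε‖ / √F.covE.trace) ^ 2) := add_sq_le
    _ = 2178 * m ^ 2 * ‖a‖ ^ 2 + 128 * (‖ε‖ ^ 2 / F.covE.trace) := by
        rw [div_pow, Real.sq_sqrt hτ.le]
        ring
    _ ≤ _ := by gcongr

theorem NoiseConditions.lt_measureReal_norm_αHat_sq_le
    (hF : F.NoiseConditions M (dimensionConstant M)) :
    1 - 5 / n < F.P.real {ω | ‖F.αHat ω‖ ^ 2 ≤ 2178 * ((M : ℝ) + 1) ^ 2 * F.normBound} := by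
  have hn : (0 : ℝ) < n := by exact_mod_cast hF.one_le_n
  have hτ := trace_pos_of_one_lt_effectiveRank
    (hF.one_lt_effectiveRank (one_le_two.trans (two_le_dimensionConstant M)))
  have hgood := one_sub_add_le_measureReal (P := F.P) (s := {ω | ¬F.WellSpreadNoise (M + 1) ω})
    (t := {ω | ∃ i, 2 * ((M : ℝ) + 1) ^ 2 * Real.log n * F.varε < F.εs i ω ^ 2})
    (u := {ω | ‖F.αHat ω‖ ^ 2 ≤ 2178 * ((M : ℝ) + 1) ^ 2 * F.normBound}) fun ω hspread hε => by
      simp only [Set.mem_ofPred_eq, not_not, not_exists, not_lt] at hspread hε ⊢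
      refine (hspread.norm_αHat_sq_le (by simp) hτ hF.one_le_K hF.fullRank hε).trans ?_
      have hrest : 0 ≤ ((M : ℝ) + 1) ^ 2 * (F.varε * (n * Real.log n / F.covE.trace)) := by
        have := F.varε_nonneg
        have := Real.log_natCast_nonneg n
        positivity
      rw [normBound]
      linear_combination 1922 * hrest
  have hfive : (5 : ℝ) / n = 2 / n + 2 / n + 1 / n := by ring
  have hone : (0 : ℝ) < 1 / n := by positivity
  linarith [hF.measureReal_not_wellSpreadNoise_le, hF.subGaussianε.measureReal_exists_lt_εs_sq_le]

theorem normBound_le_of_le_matrixOpNorm {κ : ℝ} (hκ : 0 < κ) (hop : κ ≤ matrixOpNorm F.covE)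
    (hr : 0 < effectiveRank F.covE) (hsignal : 0 ≤ F.signal / F.signalEigenvalue) :
    F.normBound ≤ max 1 κ⁻¹ * (F.signal / F.signalEigenvalue
      + F.varε * (n * Real.log n / effectiveRank F.covE)) := by
  have hv := F.varε_nonneg
  have := Real.log_natCast_nonneg n
  rw [mul_add]
  refine add_le_add (le_mul_of_one_le_left hsignal (le_max_left _ _)) ?_
  calc F.varε * (n * Real.log n / F.covE.trace)
      ≤ F.varε * (n * Real.log n / (effectiveRank F.covE * κ)) := by
        rw [← effectiveRank_mul_matrixOpNorm]
        gcongr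
    _ = κ⁻¹ * (F.varε * (n * Real.log n / effectiveRank F.covE)) := by field_simp
    _ ≤ max 1 κ⁻¹ * (F.varε * (n * Real.log n / effectiveRank F.covE)) := by
        gcongr
        exact le_max_right _ _

end FactorRegression

theorem mainTheorem6_general (M : ℝ≥0) :
    ∃ C c : ℝ, 1 ≤ C ∧ 0 < c ∧
      (∃ C' : ℝ, 0 < C' ∧ ∀ (n p K : ℕ) (F : FactorRegression.{u, v} n p K),
        F.NoiseConditions M C →
        1 - c / n < F.P.real {ω | ‖F.αHat ω‖ ^ 2 ≤ C' * (F.signal / F.signalEigenvalue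
          + F.varε * (n * Real.log n / F.covE.trace))}) ∧
      (∀ κ : ℝ, 0 < κ → ∃ C' : ℝ, 0 < C' ∧
        ∀ (n p K : ℕ) (F : FactorRegression.{u, v} n p K), F.NoiseConditions M C →
        κ ≤ matrixOpNorm F.covE →
        1 - c / n < F.P.real {ω | ‖F.αHat ω‖ ^ 2 ≤ C' * (F.signal / F.signalEigenvalue
          + F.varε * (n * Real.log n / effectiveRank F.covE))}) ∧
      (∀ (n p K : ℕ → ℕ) (F : ∀ m, FactorRegression.{u, v} (n m) (p m) (K m)),
        (∀ m, (F m).NoiseConditions M C) →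
        Tendsto n atTop atTop →
        Tendsto (fun m => (F m).signal / (F m).signalEigenvalue) atTop (𝓝 0) →
        Tendsto (fun m => (F m).varε * (n m * Real.log (n m) / (F m).covE.trace))
          atTop (𝓝 0) →
        ∀ δ : ℝ, 0 < δ →
          Tendsto (fun m => (F m).P.real {ω | ‖(F m).αHat ω‖ < δ}) atTop (𝓝 1)) := by
  have hC : 1 ≤ dimensionConstant M := one_le_two.trans (two_le_dimensionConstant M)
  refine ⟨dimensionConstant M, 5, hC, by norm_num, ⟨2178 * ((M : ℝ) + 1) ^ 2, by positivity,
    fun n p K F hF => hF.lt_measureReal_norm_αHat_sq_le⟩, fun κ hκ => ?_, ?_⟩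
  · refine ⟨2178 * ((M : ℝ) + 1) ^ 2 * max 1 κ⁻¹, by positivity, fun n p K F hF hop => ?_⟩
    have hle := FactorRegression.normBound_le_of_le_matrixOpNorm hκ hop
      (one_pos.trans (hF.one_lt_effectiveRank hC)) (hF.fullRank.signal_div_nonneg hF.one_le_K)
    refine hF.lt_measureReal_norm_αHat_sq_le.trans_le (measureReal_mono ?_)
    refine Set.ofPred_subset_ofPred.2 fun ω hω => hω.trans ?_
    rw [mul_assoc _ (max 1 κ⁻¹)]
    gcongr
  · intro n p K F hF hn hsignal hnoise δ hδ
    have hbound : Tendsto (fun m => 2178 * ((M : ℝ) + 1) ^ 2 * (F m).normBound) atTop (𝓝 0) := by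
      simpa [FactorRegression.normBound]
        using (hsignal.add hnoise).const_mul (2178 * ((M : ℝ) + 1) ^ 2)
    have hprob : Tendsto (fun m => 1 - 5 / (n m : ℝ)) atTop (𝓝 1) := by
      simpa using ((tendsto_natCast_atTop_atTop (R := ℝ)).comp hn).const_div_atTop 5
        |>.const_sub 1
    exact tendsto_measureReal_lt_of_sq_le hbound hprob
      (fun m => (hF m).lt_measureReal_norm_αHat_sq_le.le) hδ

theorem mainTheorem6 (M : ℝ≥0) :
    ∃ C c : ℝ, 0 < C ∧ 0 < c ∧
      -- the norm bound, with an absolute constant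
      (∃ C' : ℝ, 0 < C' ∧ ∀ (n p K : ℕ) (F : FactorRegression.{u, v} n p K), F.Conditions M C →
        1 - c / n < F.P.real {ω | ‖F.αHat ω‖ ^ 2 ≤ C' * (F.signal / F.signalEigenvalue
          + F.varε * (n * Real.log n / F.covE.trace))}) ∧
      -- the same bound in terms of the effective rank, if the norm of the noise covariance is
      -- bounded below
      (∀ κ : ℝ, 0 < κ → ∃ C' : ℝ, 0 < C' ∧
        ∀ (n p K : ℕ) (F : FactorRegression.{u, v} n p K), F.Conditions M C →
        κ ≤ matrixOpNorm F.covE →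
        1 - c / n < F.P.real {ω | ‖F.αHat ω‖ ^ 2 ≤ C' * (F.signal / F.signalEigenvalue
          + F.varε * (n * Real.log n / effectiveRank F.covE))}) ∧
      -- hence the norm of the estimator vanishes in probability
      (∀ (n p K : ℕ → ℕ) (F : ∀ m, FactorRegression.{u, v} (n m) (p m) (K m)),
        (∀ m, (F m).Conditions M C) →
        Tendsto n atTop atTop →
        Tendsto (fun m => (F m).signal / (F m).signalEigenvalue) atTop (𝓝 0) →
        Tendsto (fun m => (F m).varε * (n m * Real.log (n m) / (F m).covE.trace))
          atTop (𝓝 0) →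
        ∀ δ : ℝ, 0 < δ →
          Tendsto (fun m => (F m).P.real {ω | ‖(F m).αHat ω‖ < δ}) atTop (𝓝 1)) := by
  obtain ⟨C, c, hC, hc, ⟨C', hC', htrace⟩, hrank, hlim⟩ := mainTheorem6_general.{u, v} M
  refine ⟨C, c, one_pos.trans_le hC, hc,
    ⟨C', hC', fun n p K F hF => htrace n p K F (hF.noiseConditions hC)⟩, fun κ hκ => ?_,
    fun n p K F hF => hlim n p K F fun m => (hF m).noiseConditions hC⟩
  obtain ⟨C'', hC'', hbound⟩ := hrank κ hκ
  exact ⟨C'', hC'', fun n p K F hF => hbound n p K F (hF.noiseConditions hC)⟩
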